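/- Let $A$ be a finite alphabet. Let $\mathcal F(A)$ be the monoid of finite ordered forests over $A$ (written additively), and let $\mathcal C(A)$ be the monoid of contexts, i.e. forests with exactly one hole $\square$, at a leaf. A forest algebra $(H,V)$ consists of a monoid $(H,+,0)$, a monoid $V$ acting on $H$ from the left, and for each $h\in H$ elements $h+\square$ and $\square+h$ of $V$ acting as $g\mapsto h+g$ and $g\mapsto g+h$. A language $L\subseteq\mathcal F(A)$ is recognized by a finite forest algebra $(H,V)$ with a homomorphism $\varphi\colon(\mathcal F(A),\mathcal C(A))\to(H,V)$ and a set $E\subseteq H$ if $L=\varphi^{-1}(E)$. A deterministic forest automaton $((Q,+,0),\delta,E)$ consists of a finite monoid $Q$ of states, a function $\delta\colon Q\times A\to Q$ and a set $E\subseteq Q$; it accepts the forests whose value lies in $E$, where the empty forest has value $0$ and $a(f)+g$ has value $\delta(p,a)+q$ if $f,g$ have values $p,q$. **Proposition.** The languages recognizable by finite forest algebras are exactly those accepted by deterministic forest automata, and also exactly those recognizable by finite forest algebras whose action is faithful. For each finite alphabet $A$ they form a Boolean subalgebra of the power set of $\mathcal F(A)$. This Boolean algebra is effective, in logarithmic space: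 for finite forest algebras, and likewise for deterministic forest automata, replacing the accepting set by its complement recognizes $\mathcal F(A)\setminus L$, and the direct product of recognizers for $L_1$ and $L_2$ with the accepting set $\{(p,q)\mid p\in E_1\text{ and } q\in E_2\}$, respectively $\{(p,q)\mid p\in E_1\text{ or } q\in E_2\}$, recognizes $L_1\cap L_2$, respectively $L_1\cup L_2$. These constructions preserve faithfulness of forest algebras. For each of the two models and each of the three operations there is one deterministic Turing machine (read-only input tape, work tapes, write-only output tape) which, for every $m\ge 0$ and the alphabet $\{0,\dots,m-1\}$, transforms the encoding of the given recognizer(s) into that of the constructed one, using $O(\log n)$ work tape cells on inputs of length $n$. A recognizer is encoded by its operation tables: for forest algebras these are the tables of both monoids, of the action, of $h\mapsto h+\square$ and $h\mapsto\square+h$, of the images $\varphi(a(\square))$ of the letters and of $E$; for automata those of $+$, $\delta$ and $E$. Sizes, neutral elements and table entries are written in unary. -/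

import Mathlib

/-! ### Forests and contexts -/

/-- Finite ordered forests over the alphabet `A`: a forest is empty, or it is a first tree `a(f)`
(root label `a`, forest of subtrees `f`) followed by a forest `g`. -/
inductive Forest (A : Type) : Type where
  | nil : Forest A
  | cons (a : A) (f g : Forest A) : Forest A

namespace Forest

/-- Horizontal concatenation of forests. -/
def append {A : Type} : Forest A → Forest A → Forest A
  | nil, h => h
  | cons a f g, h => cons a f (append g h)

instance {A : Type} : Zero (Forest A) := ⟨nil⟩

instance {A : Type} : Add (Forest A) := ⟨append⟩

theorem zero_add' {A : Type} (h : Forest A) : 0 + h = h := rfl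

theorem cons_add {A : Type} (a : A) (f g h : Forest A) : cons a f g + h = cons a f (g + h) := rfl

theorem add_zero' {A : Type} (f : Forest A) : f + 0 = f := by
  induction f with
  | nil => rfl
  | cons a f g _ ih => rw [cons_add, ih]

theorem add_assoc' {A : Type} (f g h : Forest A) : f + g + h = f + (g + h) := by
  induction f with
  | nil => rfl
  | cons a f f' _ ih => rw [cons_add, cons_add, cons_add, ih]

instance {A : Type} : AddMonoid (Forest A) where
  add_assoc := add_assoc'
  zero_add := zero_add'
  add_zero := add_zero'
  nsmul := nsmulRec

/-- The tree with root label `a` and forest of subtrees `f`, as a forest. -/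
def tree {A : Type} (a : A) (f : Forest A) : Forest A := cons a f 0

end Forest

/-- Contexts over `A`: forests with exactly one hole `□`, which is a leaf. -/
inductive Context (A : Type) : Type where
  /-- `l + □ + r` -/
  | hole (l r : Forest A) : Context A
  /-- `l + a(c) + r` -/
  | node (l : Forest A) (a : A) (c : Context A) (r : Forest A) : Context A

namespace Context

/-- Replacing the hole by a forest. -/
def apply {A : Type} : Context A → Forest A → Forest A
  | hole l r, f => l + f + r
  | node l a c r, f => l + Forest.tree a (apply c f) + r

/-- `l + c + r` for a context `c` and forests `l`, `r`. -/
def surround {A : Type} (l : Forest A) : Context A → Forest A → Context A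
  | hole l' r', r => hole (l + l') (r' + r)
  | node l' a c r', r => node (l + l') a c (r' + r)

/-- Replacing the hole by a context. -/
def comp {A : Type} : Context A → Context A → Context A
  | hole l r, d => surround l d r
  | node l a c r, d => node l a (comp c d) r

instance {A : Type} : One (Context A) := ⟨hole 0 0⟩

instance {A : Type} : Mul (Context A) := ⟨comp⟩

theorem hole_mul {A : Type} (l r : Forest A) (d : Context A) :
    hole l r * d = surround l d r := rfl

theorem node_mul {A : Type} (l : Forest A) (a : A) (c : Context A) (r : Forest A)
    (d : Context A) : node l a c r * d = node l a (c * d) r := rfl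

theorem surround_mul {A : Type} (l : Forest A) (c : Context A) (r : Forest A) (d : Context A) :
    surround l c r * d = surround l (c * d) r := by
  cases c with
  | hole l' r' => cases d <;> simp [surround, hole_mul, add_assoc]
  | node l' a c r' => rfl

theorem mul_assoc' {A : Type} (c d e : Context A) : c * d * e = c * (d * e) := by
  induction c with
  | hole l r => rw [hole_mul, hole_mul, surround_mul]
  | node l a c r ih => rw [node_mul, node_mul, node_mul, ih]

theorem one_mul' {A : Type} (c : Context A) : 1 * c = c := by
  change surround 0 c 0 = c
  cases c <;> simp [surround]

theorem mul_one' {A : Type} (c : Context A) : c * 1 = c := by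
  induction c with
  | hole l r => change hole (l + 0) (0 + r) = _; simp
  | node l a c r ih => rw [node_mul, ih]

instance {A : Type} : Monoid (Context A) where
  mul_assoc := mul_assoc'
  one_mul := one_mul'
  mul_one := mul_one'

theorem apply_surround {A : Type} (l : Forest A) (c : Context A) (r f : Forest A) :
    apply (surround l c r) f = l + apply c f + r := by
  cases c <;> simp [surround, apply, add_assoc]

theorem apply_mul {A : Type} (c d : Context A) (f : Forest A) :
    apply (c * d) f = apply c (apply d f) := by
  induction c with
  | hole l r => rw [hole_mul, apply_surround]; rfl
  | node l a c r ih => rw [node_mul, apply, ih]; rfl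

instance {A : Type} : MulAction (Context A) (Forest A) where
  smul := apply
  one_smul f := by change 0 + f + 0 = f; simp
  mul_smul := apply_mul

/-- The context `a(□)`. -/
def letter {A : Type} (a : A) : Context A := node 0 a 1 0

end Context

/-! ### Forest algebras -/

/-- A forest algebra `(H, V)`: a horizontal monoid `H` (written additively, not assumed to be
commutative), a vertical monoid `V` acting on `H` from the left, and for every `h : H` elements
`h + □` and `□ + h` of `V`. -/
structure ForestAlgebra where
  H : Type
  V : Type
  [addMonoidH : AddMonoid H]
  [monoidV : Monoid V]
  [actionVH : MulAction V H]
  /-- `h + □` -/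
  inl : H → V
  /-- `□ + h` -/
  inr : H → V
  inl_smul : ∀ g h : H, inl g • h = g + h
  inr_smul : ∀ g h : H, inr g • h = h + g

attribute [instance] ForestAlgebra.addMonoidH ForestAlgebra.monoidV ForestAlgebra.actionVH

namespace ForestAlgebra

/-- The action of the vertical monoid is faithful. Some authors make this part of the definition
of a forest algebra. -/
def Faithful (S : ForestAlgebra) : Prop :=
  ∀ v w : S.V, (∀ h : S.H, v • h = w • h) → v = w

/-- The free forest algebra over `A`, made of all forests and all contexts. -/
def free (A : Type) : ForestAlgebra where
  H := Forest A
  V := Context A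
  inl h := Context.hole h 0
  inr h := Context.hole 0 h
  inl_smul g h := by change g + h + 0 = g + h; simp
  inr_smul g h := by change 0 + h + g = h + g; simp

/-- Homomorphisms of forest algebras. -/
structure Hom (S T : ForestAlgebra) where
  onH : S.H →+ T.H
  onV : S.V →* T.V
  map_smul : ∀ (v : S.V) (h : S.H), onH (v • h) = onV v • onH h
  map_inl : ∀ h : S.H, onV (S.inl h) = T.inl (onH h)
  map_inr : ∀ h : S.H, onV (S.inr h) = T.inr (onH h)

/-- The direct product of two forest algebras. -/
def prod (S T : ForestAlgebra) : ForestAlgebra where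
  H := S.H × T.H
  V := S.V × T.V
  actionVH :=
    { smul := fun v h => (v.1 • h.1, v.2 • h.2)
      one_smul := fun h => Prod.ext (one_smul S.V h.1) (one_smul T.V h.2)
      mul_smul := fun v w h => Prod.ext (mul_smul v.1 w.1 h.1) (mul_smul v.2 w.2 h.2) }
  inl h := (S.inl h.1, T.inl h.2)
  inr h := (S.inr h.1, T.inr h.2)
  inl_smul g h := Prod.ext (S.inl_smul g.1 h.1) (T.inl_smul g.2 h.2)
  inr_smul g h := Prod.ext (S.inr_smul g.1 h.1) (T.inr_smul g.2 h.2)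

/-- The homomorphism into a product given by its two components. -/
def Hom.pair {R S T : ForestAlgebra} (φ : Hom R S) (ψ : Hom R T) : Hom R (S.prod T) where
  onH := φ.onH.prod ψ.onH
  onV := φ.onV.prod ψ.onV
  map_smul v h := Prod.ext (φ.map_smul v h) (ψ.map_smul v h)
  map_inl h := Prod.ext (φ.map_inl h) (ψ.map_inl h)
  map_inr h := Prod.ext (φ.map_inr h) (ψ.map_inr h)

end ForestAlgebra

/-- A finite forest algebra used as a recognizer of a forest language over `A`: a forest algebra
with finitely many elements (which are numbered, so that it can be written down), a homomorphism
from the free forest algebra over `A`, and a set of accepting elements of the horizontal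
monoid. -/
structure AlgebraRecognizer (A : Type) where
  alg : ForestAlgebra
  nH : ℕ
  nV : ℕ
  numH : alg.H ≃ Fin nH
  numV : alg.V ≃ Fin nV
  hom : ForestAlgebra.Hom (ForestAlgebra.free A) alg
  accept : Set alg.H

namespace AlgebraRecognizer

/-- The recognized language: the preimage of the accepting set. -/
def language {A : Type} (R : AlgebraRecognizer A) : Set (Forest A) :=
  {f | R.hom.onH f ∈ R.accept}

/-- The complement construction. -/
def compl {A : Type} (R : AlgebraRecognizer A) : AlgebraRecognizer A :=
  { R with accept := R.acceptᶜ }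

/-- The product construction, for a given accepting set. The pair of the elements numbered
`i` and `j` gets the number `i * n + j`, where `n` is the size of the second factor. -/
def prod {A : Type} (R S : AlgebraRecognizer A) (E : Set (R.alg.H × S.alg.H)) :
    AlgebraRecognizer A where
  alg := R.alg.prod S.alg
  nH := R.nH * S.nH
  nV := R.nV * S.nV
  numH := (R.numH.prodCongr S.numH).trans finProdFinEquiv
  numV := (R.numV.prodCongr S.numV).trans finProdFinEquiv
  hom := R.hom.pair S.hom
  accept := E

/-- The product construction for the intersection. -/
def inter {A : Type} (R S : AlgebraRecognizer A) : AlgebraRecognizer A :=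
  R.prod S {p | p.1 ∈ R.accept ∧ p.2 ∈ S.accept}

/-- The product construction for the union. -/
def union {A : Type} (R S : AlgebraRecognizer A) : AlgebraRecognizer A :=
  R.prod S {p | p.1 ∈ R.accept ∨ p.2 ∈ S.accept}

end AlgebraRecognizer

/-- The languages recognizable by finite forest algebras. -/
def AlgebraRecognizable {A : Type} (L : Set (Forest A)) : Prop :=
  ∃ R : AlgebraRecognizer A, R.language = L

/-! ### Deterministic forest automata -/

/-- A deterministic forest automaton over `A`: a finite monoid `(Q, +, 0)` of states (numbered,
so that the automaton can be written down), a transition function and a set of accepting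
states. -/
structure ForestAutomaton (A : Type) where
  Q : Type
  [addMonoidQ : AddMonoid Q]
  n : ℕ
  num : Q ≃ Fin n
  δ : Q → A → Q
  accept : Set Q

attribute [instance] ForestAutomaton.addMonoidQ

namespace ForestAutomaton

/-- The state reached on a forest: `0` on the empty forest, and on `a(f) + g` the sum of
`δ(p, a)` and `q`, where `p` and `q` are the states reached on `f` and `g`. -/
def eval {A : Type} (M : ForestAutomaton A) : Forest A → M.Q
  | Forest.nil => 0
  | Forest.cons a f g => M.δ (M.eval f) a + M.eval g

/-- The accepted language. -/
def language {A : Type} (M : ForestAutomaton A) : Set (Forest A) :=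
  {f | M.eval f ∈ M.accept}

/-- The complement construction. -/
def compl {A : Type} (M : ForestAutomaton A) : ForestAutomaton A :=
  { M with accept := M.acceptᶜ }

/-- The product construction, for a given accepting set. -/
def prod {A : Type} (M N : ForestAutomaton A) (E : Set (M.Q × N.Q)) : ForestAutomaton A where
  Q := M.Q × N.Q
  n := M.n * N.n
  num := (M.num.prodCongr N.num).trans finProdFinEquiv
  δ q a := (M.δ q.1 a, N.δ q.2 a)
  accept := E

/-- The product construction for the intersection. -/
def inter {A : Type} (M N : ForestAutomaton A) : ForestAutomaton A :=
  M.prod N {p | p.1 ∈ M.accept ∧ p.2 ∈ N.accept}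

/-- The product construction for the union. -/
def union {A : Type} (M N : ForestAutomaton A) : ForestAutomaton A :=
  M.prod N {p | p.1 ∈ M.accept ∨ p.2 ∈ N.accept}

end ForestAutomaton

/-- The languages accepted by deterministic forest automata. -/
def AutomatonRecognizable {A : Type} (L : Set (Forest A)) : Prop :=
  ∃ M : ForestAutomaton A, M.language = L

/-! ### Encodings as bit strings

A recognizer over the alphabet `{0, …, m - 1}` is written down through its operation tables, each
entry being the number of an element. Numbers are written in unary; as none of them exceeds the
length of the tables, binary notation would give strings of polynomially
related length. -/

/-- A list of natural numbers as a bit string: `x` is written as `1…10` with `x` ones. -/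
def encodeNats (l : List ℕ) : List Bool :=
  l.flatMap fun x => List.replicate x true ++ [false]

/-- The table of a function of one argument. -/
def table₁ {n k : ℕ} (f : Fin n → Fin k) : List ℕ :=
  (List.finRange n).map fun i => (f i : ℕ)

/-- The table of a function of two arguments, row by row. -/
def table₂ {n m k : ℕ} (f : Fin n → Fin m → Fin k) : List ℕ :=
  (List.finRange n).flatMap fun i => table₁ (f i)

open Classical in
/-- The characteristic sequence of a set of numbers. -/
noncomputable def tableSet {n : ℕ} (E : Set (Fin n)) : List ℕ :=
  (List.finRange n).map fun i => if i ∈ E then 1 else 0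

/-- Sizes, neutral elements, the tables of the operations of the forest algebra, the images of
the contexts `a(□)` (which determine the homomorphism on forests), and the accepting set. -/
noncomputable def AlgebraRecognizer.encode {m : ℕ} (R : AlgebraRecognizer (Fin m)) : List Bool :=
  encodeNats
    ([m, R.nH, R.nV, (R.numH 0 : ℕ), (R.numV 1 : ℕ)]
      ++ table₂ (fun i j => R.numH (R.numH.symm i + R.numH.symm j))
      ++ table₂ (fun i j => R.numV (R.numV.symm i * R.numV.symm j))
      ++ table₂ (fun i j => R.numH (R.numV.symm i • R.numH.symm j))
      ++ table₁ (fun i => R.numV (R.alg.inl (R.numH.symm i)))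
      ++ table₁ (fun i => R.numV (R.alg.inr (R.numH.symm i)))
      ++ table₁ (fun a : Fin m => R.numV (R.hom.onV (Context.letter a)))
      ++ tableSet {i | R.numH.symm i ∈ R.accept})

/-- Sizes, the neutral element, the tables of the addition and of the transition function, and
the accepting set. -/
noncomputable def ForestAutomaton.encode {m : ℕ} (M : ForestAutomaton (Fin m)) : List Bool :=
  encodeNats
    ([m, M.n, (M.num 0 : ℕ)]
      ++ table₂ (fun i j => M.num (M.num.symm i + M.num.symm j))
      ++ table₂ (fun i (a : Fin m) => M.num (M.δ (M.num.symm i) a))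
      ++ tableSet {i | M.num.symm i ∈ M.accept})

/-! ### Turing machines with logarithmic space -/

/-- What the input head sees: an end marker or an input bit. -/
inductive InputSymbol : Type where
  | leftEnd
  | bit (b : Bool)
  | rightEnd

/-- Head movements. -/
inductive HeadMove : Type where
  | left
  | stay
  | right

/-- A deterministic Turing machine with a two-way read-only input tape between end markers, `k`
read-write work tapes that are infinite to the right, and a write-only output tape. Given the
state, the input symbol and the work symbols under the heads, it halts (`none`) or chooses the
next state, the move of the input head, what to write and how to move on each work tape, and
at most one bit to append to the output. -/
structure TuringTransducer where
  k : ℕ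
  State : Type
  [finiteState : Finite State]
  Symbol : Type
  [finiteSymbol : Finite Symbol]
  blank : Symbol
  start : State
  next : State → InputSymbol → (Fin k → Symbol) →
    Option (State × HeadMove × (Fin k → Symbol × HeadMove) × Option Bool)

namespace TuringTransducer

/-- Configurations. Position `0` of the input head is the left end marker, position `p + 1` is the
`p`-th input bit, and the position after the last bit is the right end marker. -/
structure Config (M : TuringTransducer) where
  state : M.State
  inputPos : ℕ
  work : Fin M.k → ℕ → M.Symbol
  workPos : Fin M.k → ℕ
  output : List Bool

/-- The symbol at a position of the input tape. -/
def readInput (w : List Bool) : ℕ → InputSymbol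
  | 0 => InputSymbol.leftEnd
  | p + 1 => match w[p]? with
    | some b => InputSymbol.bit b
    | none => InputSymbol.rightEnd

/-- Moving a head; it stays where it is when told to move left from position `0`. -/
def moveHead : HeadMove → ℕ → ℕ
  | HeadMove.left, p => p - 1
  | HeadMove.stay, p => p
  | HeadMove.right, p => p + 1

/-- The initial configuration. -/
def init (M : TuringTransducer) : M.Config where
  state := M.start
  inputPos := 0
  work := fun _ _ => M.blank
  workPos := fun _ => 0
  output := []

/-- One step on the input `w`, or `none` if the machine halts. The input head does not move
beyond the right end marker. -/
def step (M : TuringTransducer) (w : List Bool) (c : M.Config) : Option M.Config :=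
  (M.next c.state (readInput w c.inputPos) fun i => c.work i (c.workPos i)).map
    fun (q, d, u, o) =>
      { state := q
        inputPos := min (moveHead d c.inputPos) (w.length + 1)
        work := fun i => Function.update (c.work i) (c.workPos i) (u i).1
        workPos := fun i => moveHead (u i).2 (c.workPos i)
        output := c.output ++ o.toList }

/-- `c'` can be reached from `c` in finitely many steps on the input `w`. -/
def Reaches (M : TuringTransducer) (w : List Bool) : M.Config → M.Config → Prop :=
  Relation.ReflTransGen fun c c' => M.step w c = some c'

/-- On the input `w` the machine halts with output `y`, and on every work tape it visits only
the first `s` cells. -/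
def ComputesInSpace (M : TuringTransducer) (w y : List Bool) (s : ℕ) : Prop :=
  (∃ c, M.Reaches w M.init c ∧ M.step w c = none ∧ c.output = y) ∧
  ∀ c, M.Reaches w M.init c → ∀ i, c.workPos i < s

end TuringTransducer

/-- Some Turing machine transforms, for all `i`, the string `inp i` into the string `out i`, in
space `O(log n)` for inputs of length `n`. -/
def LogspaceComputable {ι : Type*} (inp out : ι → List Bool) : Prop :=
  ∃ (M : TuringTransducer) (C : ℕ),
    ∀ i, M.ComputesInSpace (inp i) (out i) (C * (Nat.log 2 (inp i).length + 1))

/-! ### Fragments of Turing machines -/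

/-! The proposition has an algebraic half and a computational half.

Algebra. Since `a(f) + g = a(□)·f + g`, a homomorphism `φ` from the free forest algebra is
determined on forests by the images of the contexts `a(□)`. Hence a recognizer becomes an automaton
with state monoid `H` and `δ(q, a) = φ(a(□))·q` (`AlgebraRecognizer.eval_automaton`). Conversely,
the state monoid `Q` of an automaton is the horizontal monoid of a forest algebra whose vertical
monoid consists of all maps `Q → Q`; it is finite and acts faithfully
(`ForestAutomaton.exists_faithful_recognizer`). This closes the circle of equivalences.
Complementation changes only the accepting set, and a product evaluates forests componentwise, which
gives the Boolean operations.

Computation. The six Turing machines are obtained from one compiler. The language `NatProg` has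
bounded loops and writes values of arithmetic expressions with random access to the list of input
numbers. By `NatExpr.eval_le` all values are at most `b ^ D`, where `b` is linear in the input
length and `D` depends only on the program. So a fixed number of binary counters with `O(log n)`
bits suffices. Random access is a scan of the unary input that counts terminators, and output in
unary is written by a loop, so that no long string is ever stored. Programs are compiled into
composable machine fragments whose runs carry the space bound (`NatProg.runs_compile`); as machines
are deterministic, one bounded halting run bounds all reachable configurations
(`Fragment.Runs.computesInSpace`). The result is `NatProg.logspaceComputable`.

It remains to write the constructions as such programs. The pair of `i` and `j` is numbered `i * n +
j`, so a product table is listed by nested loops over the rows and columns of the factors, the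
entries being combined by the same formula (`NatProg.eval_prodTable`). The positions of the tables
are computed from the sizes at the beginning of the encoding. -/

instance : Finite InputSymbol :=
  Finite.of_surjective
    (fun o : Option (Option Bool) => match o with
      | none => InputSymbol.leftEnd
      | some none => InputSymbol.rightEnd
      | some (some b) => InputSymbol.bit b)
    fun x => match x with
      | .leftEnd => ⟨none, rfl⟩
      | .rightEnd => ⟨some none, rfl⟩
      | .bit b => ⟨some (some b), rfl⟩

/-- A configuration of a Turing machine without its state. The work alphabet is `InputSymbol`:
the work tapes carry an end marker in their first cell, and `rightEnd` is the blank. -/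
@[ext] structure Tapes (k : ℕ) where
  inputPos : ℕ
  work : Fin k → ℕ → InputSymbol
  workPos : Fin k → ℕ
  output : List Bool

/-- What a machine does in one step, apart from choosing the next state. -/
abbrev TapeAction (k : ℕ) : Type :=
  HeadMove × (Fin k → InputSymbol × HeadMove) × Option Bool

/-- The effect of an action on the input `w`. -/
def Tapes.act {k : ℕ} (w : List Bool) (T : Tapes k) (α : TapeAction k) : Tapes k where
  inputPos := min (TuringTransducer.moveHead α.1 T.inputPos) (w.length + 1)
  work i := Function.update (T.work i) (T.workPos i) (α.2.1 i).1
  workPos i := TuringTransducer.moveHead (α.2.1 i).2 (T.workPos i)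
  output := T.output ++ α.2.2.toList

/-- A piece of a Turing machine with `k` work tapes, which is left through one of the exits
in `E`. -/
structure Fragment (k : ℕ) (E : Type) where
  State : Type
  [finiteState : Finite State]
  start : State
  next : State → InputSymbol → (Fin k → InputSymbol) → (State ⊕ E) × TapeAction k

attribute [instance] Fragment.finiteState

namespace Fragment

/-! ### Simulation, sequential composition and iteration of fragments. -/

variable {k : ℕ} {E E' : Type}

/-- One step on the input `w`, after which all work heads are on the first `s` cells. -/
inductive Step (F : Fragment k E) (w : List Bool) (s : ℕ) :
    (F.State ⊕ E) × Tapes k → (F.State ⊕ E) × Tapes k → Prop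
  | mk (q : F.State) (T : Tapes k) (x : F.State ⊕ E) (α : TapeAction k)
      (hx : F.next q (TuringTransducer.readInput w T.inputPos) (fun i => T.work i (T.workPos i))
        = (x, α))
      (hs : ∀ i, (T.act w α).workPos i < s) : Step F w s (Sum.inl q, T) (x, T.act w α)

/-- Started on `T`, the fragment is left through the exit `e` with `T'`, and all work heads stay
on the first `s` cells. -/
def Runs (F : Fragment k E) (w : List Bool) (s : ℕ) (T : Tapes k) (e : E) (T' : Tapes k) : Prop :=
  Relation.ReflTransGen (F.Step w s) (Sum.inl F.start, T) (Sum.inr e, T')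

/-- Simulation principle behind `bind` and `loop`: `g` embeds the states of `F` into those of `G`,
while `f` may also turn an exit of `F` into a state of `G`, where the run then continues. -/
theorem steps_map {F : Fragment k E} {G : Fragment k E'} {w : List Bool} {s : ℕ}
    (f : F.State ⊕ E → G.State ⊕ E') (g : F.State → G.State)
    (hg : ∀ q, f (Sum.inl q) = Sum.inl (g q))
    (hf : ∀ q x y, G.next (g q) x y = (f (F.next q x y).1, (F.next q x y).2))
    {a b : (F.State ⊕ E) × Tapes k} (h : Relation.ReflTransGen (F.Step w s) a b) :
    Relation.ReflTransGen (G.Step w s) (f a.1, a.2) (f b.1, b.2) := by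
  refine Relation.ReflTransGen.lift
    (fun c : (F.State ⊕ E) × Tapes k => (f c.1, c.2)) ?_ _ _ h
  rintro _ _ ⟨q, T, x, α, hx, hs⟩
  change G.Step w s (f (Sum.inl q), T) (f x, _)
  rw [hg]
  exact .mk _ _ _ _ (by rw [hf, hx]) hs

/-- The fragment `F`, followed by the fragment `G e` when `F` is left through the exit `e`. -/
def bind [Finite E] (F : Fragment k E) (G : E → Fragment k E') : Fragment k E' where
  State := F.State ⊕ Σ e, (G e).State
  start := Sum.inl F.start
  next q x y := match q with
    | Sum.inl q => match F.next q x y with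
      | (Sum.inl q', α) => (Sum.inl (Sum.inl q'), α)
      | (Sum.inr e, α) => (Sum.inl (Sum.inr ⟨e, (G e).start⟩), α)
    | Sum.inr ⟨e, q⟩ => match (G e).next q x y with
      | (Sum.inl q', α) => (Sum.inl (Sum.inr ⟨e, q'⟩), α)
      | (Sum.inr e', α) => (Sum.inr e', α)

theorem Runs.bind [Finite E] {F : Fragment k E} {G : E → Fragment k E'} {w : List Bool} {s : ℕ}
    {T T' T'' : Tapes k} {e : E} {e' : E'} (hF : F.Runs w s T e T')
    (hG : (G e).Runs w s T' e' T'') : (F.bind G).Runs w s T e' T'' := by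
  have h₁ := steps_map (G := F.bind G)
    (Sum.elim (fun q => Sum.inl (Sum.inl q)) fun e => Sum.inl (Sum.inr ⟨e, (G e).start⟩))
    Sum.inl (fun _ => rfl) (fun q x y => by
      simp only [Fragment.bind]
      rcases F.next q x y with ⟨q' | e, α⟩ <;> rfl) hF
  have h₂ := steps_map (G := F.bind G)
    (Sum.elim (fun q => Sum.inl (Sum.inr ⟨e, q⟩)) Sum.inr)
    (fun q => Sum.inr ⟨e, q⟩) (fun _ => rfl) (fun q x y => by
      simp only [Fragment.bind]
      rcases (G e).next q x y with ⟨q' | e, α⟩ <;> rfl) hG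
  exact Relation.ReflTransGen.trans h₁ h₂

/-- The fragment `F`, started again each time it is left through the exit `none`. -/
def loop (F : Fragment k (Option E)) : Fragment k E where
  State := F.State
  start := F.start
  next q x y := match F.next q x y with
    | (Sum.inl q', α) => (Sum.inl q', α)
    | (Sum.inr none, α) => (Sum.inl F.start, α)
    | (Sum.inr (some e), α) => (Sum.inr e, α)

theorem steps_loop {F : Fragment k (Option E)} {w : List Bool} {s : ℕ}
    {a b : (F.State ⊕ Option E) × Tapes k} (h : Relation.ReflTransGen (F.Step w s) a b) :
    Relation.ReflTransGen (F.loop.Step w s)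
      (Sum.elim Sum.inl (fun o : Option E => o.elim (Sum.inl F.start) Sum.inr) a.1, a.2)
      (Sum.elim Sum.inl (fun o : Option E => o.elim (Sum.inl F.start) Sum.inr) b.1, b.2) :=
  steps_map (F := F) (G := F.loop) (Sum.elim Sum.inl (fun o : Option E => o.elim (Sum.inl F.start) Sum.inr)) id
    (fun _ => rfl) (fun q x y => by
      simp only [loop, id]
      rcases F.next q x y with ⟨q' | _ | e, α⟩ <;> rfl) h

theorem Runs.loop_again {F : Fragment k (Option E)} {w : List Bool} {s : ℕ} {T T' T'' : Tapes k}
    {e : E} (h : F.Runs w s T none T') (h' : F.loop.Runs w s T' e T'') :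
    F.loop.Runs w s T e T'' :=
  Relation.ReflTransGen.trans (steps_loop h) h'

theorem Runs.loop_exit {F : Fragment k (Option E)} {w : List Bool} {s : ℕ} {T T' : Tapes k}
    {e : E} (h : F.Runs w s T (some e) T') : F.loop.Runs w s T e T' :=
  steps_loop h

/-- A single step that reads from the input tape, moves the input head and may write a bit of
output. -/
def single (f : InputSymbol → E × HeadMove × Option Bool) : Fragment k E where
  State := Unit
  start := ()
  next _ x y := (Sum.inr (f x).1, (f x).2.1, fun i => (y i, HeadMove.stay), (f x).2.2)

/-- Writing back the scanned symbols and leaving the heads in place does not change the work tapes.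
-/
theorem runs_single (f : InputSymbol → E × HeadMove × Option Bool) {w : List Bool} {s : ℕ}
    {T : Tapes k} (hT : ∀ i, T.workPos i < s) {e : E} {m : HeadMove} {o : Option Bool}
    (hf : f (TuringTransducer.readInput w T.inputPos) = (e, m, o)) :
    (single f).Runs w s T e
      { T with
        inputPos := min (TuringTransducer.moveHead m T.inputPos) (w.length + 1)
        output := T.output ++ o.toList } := by
  have h : { T with
        inputPos := min (TuringTransducer.moveHead m T.inputPos) (w.length + 1)
        output := T.output ++ o.toList } =
      T.act w (m, fun i => (T.work i (T.workPos i), HeadMove.stay), o) := by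
    ext <;> simp [Tapes.act, TuringTransducer.moveHead]
  rw [h]
  refine Relation.ReflTransGen.single (.mk _ _ _ _ ?_ ?_)
  · simp [single, hf]
  · intro i
    simpa [Tapes.act, TuringTransducer.moveHead] using hT i

/-- A step that writes the end marker on all work tapes. -/
def mark : Fragment k Unit where
  State := Unit
  start := ()
  next _ _ _ := (Sum.inr (), HeadMove.stay, fun _ => (InputSymbol.leftEnd, HeadMove.right), none)

/-- A Turing machine that behaves like a given fragment and halts at the exit. -/
def toTransducer (F : Fragment k Unit) : TuringTransducer where
  k := k
  State := F.State ⊕ Unit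
  Symbol := InputSymbol
  blank := InputSymbol.rightEnd
  start := Sum.inl F.start
  next q x y := match q with
    | Sum.inl q => some (F.next q x y)
    | Sum.inr _ => none

/-- The tapes at the beginning of a computation. -/
def initTapes (k : ℕ) : Tapes k := ⟨0, fun _ _ => InputSymbol.rightEnd, fun _ => 0, []⟩

/-- A configuration of the Turing machine. -/
def config (F : Fragment k Unit) (c : (F.State ⊕ Unit) × Tapes k) : F.toTransducer.Config :=
  ⟨c.1, c.2.inputPos, c.2.work, c.2.workPos, c.2.output⟩

theorem step_config {F : Fragment k Unit} {w : List Bool} {s : ℕ}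
    {c c' : (F.State ⊕ Unit) × Tapes k} (h : F.Step w s c c') :
    F.toTransducer.step w (F.config c) = some (F.config c') := by
  obtain ⟨q, T, x, α, hx, hs⟩ := h
  simp only [TuringTransducer.step, config, toTransducer, hx]
  rfl

/-- A space bound concerns every reachable configuration, whereas `Runs` provides a single bounded
run. By determinism the configurations on this run are the only reachable ones. -/
theorem Runs.computesInSpace {F : Fragment k Unit} {w : List Bool} {s : ℕ} (hs : 0 < s)
    {T : Tapes k} (h : F.Runs w s (initTapes k) () T) :
    F.toTransducer.ComputesInSpace w T.output s := by
  have hhalt : F.toTransducer.step w (F.config (Sum.inr (), T)) = none := rfl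
  refine ⟨⟨F.config (Sum.inr (), T), ?_, hhalt, rfl⟩, ?_⟩
  · exact Relation.ReflTransGen.lift F.config (fun _ _ h => step_config h) _ _ h
  -- Induction along the run from its end: a path from `a` is either empty or begins with the step
  -- of the run, because `step` is a function. From the halting configuration no step is possible.
  · have key : ∀ a : (F.State ⊕ Unit) × Tapes k, (∀ i, a.2.workPos i < s) →
        Relation.ReflTransGen (F.Step w s) a (Sum.inr (), T) →
        ∀ c, F.toTransducer.Reaches w (F.config a) c → ∀ i, c.workPos i < s := by
      intro a ha h
      induction h using Relation.ReflTransGen.head_induction_on with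
      | refl =>
        intro c hc
        rcases Relation.ReflTransGen.cases_head hc with rfl | ⟨d, hd, -⟩
        · exact ha
        · rw [hhalt] at hd; cases hd
      | head hab _ ih =>
        intro c hc
        rcases Relation.ReflTransGen.cases_head hc with rfl | ⟨d, hd, hdc⟩
        · exact ha
        · have hb := step_config hab
          rw [hb] at hd
          cases hd
          refine ih ?_ c hdc
          obtain ⟨_, _, _, _, _, hs⟩ := hab
          exact hs
    exact key _ (fun _ => hs) h

end Fragment

/-! ### Binary counters -/

/-- Adding one to a number in binary notation, least significant bit first. -/
def incrBits : List Bool → List Bool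
  | [] => [true]
  | false :: l => true :: l
  | true :: l => false :: incrBits l

/-- Only odd numbers cause a carry: `(2c + 1) + 1 = 2(c + 1)`, so the claim for `c` is used. -/
theorem bits_succ (n : ℕ) : (n + 1).bits = incrBits n.bits := by
  induction n using Nat.strong_induction_on with
  | _ n ih =>
    obtain ⟨c, rfl | rfl⟩ := n.even_or_odd'
    · rcases Nat.eq_zero_or_pos c with rfl | hc
      · simp [incrBits]
      · rw [Nat.bit1_bits, Nat.bit0_bits _ hc.ne', incrBits]
    · rw [Nat.bit1_bits, incrBits, ← ih c (by lia), ← Nat.bit0_bits _ c.succ_ne_zero]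
      congr 1

/-- Needed because registers are compared bit by bit. Evaluating the binary expansion is a left
inverse. -/
theorem bits_injective : Function.Injective Nat.bits := by
  refine Function.LeftInverse.injective
    (g := List.foldr (fun b n => 2 * n + b.toNat) 0) fun n => ?_
  induction n using Nat.strong_induction_on with
  | _ n ih =>
    obtain ⟨c, rfl | rfl⟩ := n.even_or_odd'
    · rcases Nat.eq_zero_or_pos c with rfl | hc
      · simp
      · rw [Nat.bit0_bits _ hc.ne', List.foldr_cons, ih c (by lia)]; simp
    · rw [Nat.bit1_bits, List.foldr_cons, ih c (by lia)]; simp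

/-! ### Bit strings as contents of work tapes. -/

open TuringTransducer (readInput)

/-- Work tapes reuse `readInput l` as their contents: the end marker in cell `0`, the bits of `l` in
the cells `1, …, l.length`, and the blank `rightEnd` in all others. -/
theorem readInput_append_cons (pre suf : List Bool) (b : Bool) :
    readInput (pre ++ b :: suf) (pre.length + 1) = InputSymbol.bit b := by
  simp [readInput]

theorem readInput_length (l : List Bool) :
    readInput l (l.length + 1) = InputSymbol.rightEnd := by
  simp [readInput]

theorem readInput_of_le (l : List Bool) {p : ℕ} (hp : p < l.length) :
    readInput l (p + 1) = InputSymbol.bit l[p] := by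
  simp [readInput, hp]

theorem update_readInput (pre suf : List Bool) (a b : Bool) :
    Function.update (readInput (pre ++ a :: suf)) (pre.length + 1) (InputSymbol.bit b) =
      readInput (pre ++ b :: suf) := by
  funext p
  rcases p with _ | p
  · rw [Function.update_of_ne (by lia)]; rfl
  · rcases eq_or_ne p pre.length with rfl | hp
    · rw [Function.update_self, readInput_append_cons]
    · rw [Function.update_of_ne (by lia)]
      simp only [readInput]
      rcases lt_or_gt_of_ne hp with h | h
      · simp [List.getElem?_append_left h]
      · rw [List.getElem?_append_right h.le, List.getElem?_append_right h.le]
        obtain ⟨j, hj⟩ : ∃ j, p - pre.length = j + 1 := ⟨p - pre.length - 1, by lia⟩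
        simp [hj]

theorem readInput_concat (l : List Bool) (b : Bool) :
    readInput (l ++ [b]) =
      Function.update (readInput l) (l.length + 1) (InputSymbol.bit b) := by
  funext p
  rcases p with _ | p
  · rw [Function.update_of_ne (by lia)]; rfl
  · rcases lt_trichotomy p l.length with h | rfl | h
    · rw [Function.update_of_ne (by lia)]; simp [readInput, List.getElem?_append_left h]
    · rw [Function.update_self, readInput_append_cons]
    · rw [Function.update_of_ne (by lia)]
      have h1 : (l ++ [b])[p]? = none := by rw [List.getElem?_eq_none_iff]; simp; lia
      have h2 : l[p]? = none := by rw [List.getElem?_eq_none_iff]; lia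
      simp [readInput, h1, h2]

theorem update_readInput_concat (l : List Bool) (b : Bool) :
    Function.update (readInput (l ++ [b])) (l.length + 1) InputSymbol.rightEnd =
      readInput l := by
  rw [readInput_concat, Function.update_idem, ← readInput_length l, Function.update_eq_self]

/-- Replacing the contents of a work tape and the position of its head. -/
def Tapes.setTape {k : ℕ} (T : Tapes k) (i : Fin k) (f : ℕ → InputSymbol) (p : ℕ) : Tapes k :=
  { T with work := Function.update T.work i f, workPos := Function.update T.workPos i p }

namespace Fragment

variable {k : ℕ} {E : Type} {w : List Bool} {s : ℕ}

/-- A step that neither moves the input head nor writes output, and that acts on the `i`-th work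
tape only. -/
def onTape (i : Fin k) (y : Fin k → InputSymbol) (x : InputSymbol) (m : HeadMove) :
    TapeAction k :=
  (HeadMove.stay, Function.update (fun j => (y j, HeadMove.stay)) i (x, m), none)

/-- The bound on the input position is needed since even a step that keeps the input head in place
truncates its position at the right end marker. -/
theorem act_onTape {T : Tapes k} (hT : T.inputPos ≤ w.length + 1) (i : Fin k)
    (f : ℕ → InputSymbol) (p : ℕ) (x : InputSymbol) (m : HeadMove) :
    (T.setTape i f p).act w (onTape i
      (fun j => (T.setTape i f p).work j ((T.setTape i f p).workPos j)) x m) =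
    T.setTape i (Function.update f p x) (TuringTransducer.moveHead m p) := by
  ext j
  · simp [Tapes.act, Tapes.setTape, onTape, TuringTransducer.moveHead, hT]
  · rcases eq_or_ne j i with rfl | hj
    · simp [Tapes.act, Tapes.setTape, onTape]
    · simp [Tapes.act, Tapes.setTape, onTape, hj]
  · rcases eq_or_ne j i with rfl | hj
    · simp [Tapes.act, Tapes.setTape, onTape]
    · simp [Tapes.act, Tapes.setTape, onTape, hj, TuringTransducer.moveHead]
  · simp [Tapes.act, Tapes.setTape, onTape]

/-- The transition is required only for symbol vectors `y` with the right symbol on tape `i`; the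
other tapes are irrelevant. -/
theorem step_onTape {F : Fragment k E} {T : Tapes k} (hT : T.inputPos ≤ w.length + 1)
    (hs : ∀ j, T.workPos j < s) {i : Fin k} {f : ℕ → InputSymbol} {p : ℕ} {x : InputSymbol}
    {m : HeadMove} {q : F.State} {q' : F.State ⊕ E}
    (h : ∀ z y, y i = f p → F.next q z y = (q', onTape i y x m))
    (hm : TuringTransducer.moveHead m p < s) :
    F.Step w s (Sum.inl q, T.setTape i f p)
      (q', T.setTape i (Function.update f p x) (TuringTransducer.moveHead m p)) := by
  rw [← act_onTape hT]
  refine .mk _ _ _ _ (h _ _ (by simp [Tapes.setTape])) fun j => ?_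
  rw [act_onTape hT]
  rcases eq_or_ne j i with rfl | hj
  · simpa [Tapes.setTape] using hm
  · simpa [Tapes.setTape, hj] using hs j

/-- Incrementing the binary counter on the `i`-th work tape. The states tell whether the head is
on its way back. -/
def incTape (i : Fin k) : Fragment k Unit where
  State := Bool
  start := false
  next q _ y := match q, y i with
    | false, .bit true => (Sum.inl false, onTape i y (.bit false) .right)
    | false, _ => (Sum.inl true, onTape i y (.bit true) .left)
    | true, .leftEnd => (Sum.inr (), onTape i y .leftEnd .right)
    | true, x => (Sum.inl true, onTape i y x .left)

theorem steps_incTape_back {T : Tapes k} (hT : T.inputPos ≤ w.length + 1)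
    (hs : ∀ j, T.workPos j < s) (i : Fin k) (l : List Bool) (hl : l.length + 1 < s) (p : ℕ)
    (hp : p ≤ l.length) :
    Relation.ReflTransGen ((incTape i).Step w s)
      (Sum.inl true, T.setTape i (readInput l) p) (Sum.inr (), T.setTape i (readInput l) 1) := by
  induction p with
  | zero =>
    refine .single ?_
    have h := step_onTape (F := incTape i) hT hs (f := readInput l) (p := 0) (q := true)
      (q' := Sum.inr ()) (x := .leftEnd) (m := .right) (i := i)
      (fun z y hy => by
        change y i = InputSymbol.leftEnd at hy
        simp [incTape, hy]) (by simp [TuringTransducer.moveHead]; lia)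
    have h' : Function.update (readInput l) 0 InputSymbol.leftEnd = readInput l :=
      Function.update_eq_self 0 (readInput l)
    rwa [h'] at h
  | succ p ih =>
    have h := step_onTape (F := incTape i) hT hs (f := readInput l) (p := p + 1) (q := true)
      (q' := Sum.inl true) (x := readInput l (p + 1)) (m := .left) (i := i)
      (fun z y hy => by
        rw [readInput_of_le l hp] at hy ⊢
        simp [incTape, hy]) (by simp [TuringTransducer.moveHead]; lia)
    rw [Function.update_eq_self] at h
    exact .head h (ih (by lia))

/-- Here `pre` is the part behind the head, already rewritten, and the carry is about to enter
`suf`. The `+ 2` leaves room for the end marker and for one additional bit when the carry runs off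
the end. -/
theorem steps_incTape {T : Tapes k} (hT : T.inputPos ≤ w.length + 1)
    (hs : ∀ j, T.workPos j < s) (i : Fin k) (suf pre : List Bool)
    (hl : (pre ++ suf).length + 2 < s) :
    Relation.ReflTransGen ((incTape i).Step w s)
      (Sum.inl false, T.setTape i (readInput (pre ++ suf)) (pre.length + 1))
      (Sum.inr (), T.setTape i (readInput (pre ++ incrBits suf)) 1) := by
  have hl' := hl
  rw [List.length_append] at hl'
  induction suf generalizing pre with
  | nil =>
    have h := step_onTape (F := incTape i) hT hs (f := readInput pre) (p := pre.length + 1)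
      (q := false) (q' := Sum.inl true) (x := .bit true) (m := .left) (i := i)
      (fun z y hy => by
        rw [readInput_length] at hy
        simp [incTape, hy]) (by simp [TuringTransducer.moveHead]; lia)
    rw [← readInput_concat] at h
    rw [List.append_nil]
    refine .head h (steps_incTape_back hT hs i (pre ++ [true]) ?_ _ ?_)
    · simp; simp at hl'; lia
    · simp [TuringTransducer.moveHead]
  | cons b suf ih =>
    rw [List.length_cons] at hl'
    cases b with
    | false =>
      have h := step_onTape (F := incTape i) hT hs (f := readInput (pre ++ false :: suf))
        (p := pre.length + 1) (q := false) (q' := Sum.inl true) (x := .bit true) (m := .left)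
        (i := i)
        (fun z y hy => by
          rw [readInput_append_cons] at hy
          simp [incTape, hy]) (by simp [TuringTransducer.moveHead]; lia)
      rw [update_readInput] at h
      refine .head h (steps_incTape_back hT hs i (pre ++ true :: suf) ?_ _ ?_)
      · simp; lia
      · simp [TuringTransducer.moveHead]
    | true =>
      have h := step_onTape (F := incTape i) hT hs (f := readInput (pre ++ true :: suf))
        (p := pre.length + 1) (q := false) (q' := Sum.inl false) (x := .bit false) (m := .right)
        (i := i)
        (fun z y hy => by
          rw [readInput_append_cons] at hy
          simp [incTape, hy]) (by simp [TuringTransducer.moveHead]; lia)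
      rw [update_readInput] at h
      have ih' := ih (pre ++ [false]) (by simp; lia) (by simp; lia)
      simp only [List.append_assoc, List.singleton_append, List.length_append,
        List.length_singleton] at ih'
      exact .head h ih'

/-- Erasing the `i`-th work tape up to the end marker. The states tell whether the head is on its
way back. -/
def clearTape (i : Fin k) : Fragment k Unit where
  State := Bool
  start := false
  next q _ y := match q, y i with
    | false, .bit b => (Sum.inl false, onTape i y (.bit b) .right)
    | false, _ => (Sum.inl true, onTape i y .rightEnd .left)
    | true, .leftEnd => (Sum.inr (), onTape i y .leftEnd .right)
    | true, _ => (Sum.inl true, onTape i y .rightEnd .left)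

/-- Erasing proceeds from the last bit to the first, hence the induction from the right end of `l`;
the head always stands on the last remaining bit. -/
theorem steps_clearTape_back {T : Tapes k} (hT : T.inputPos ≤ w.length + 1)
    (hs : ∀ j, T.workPos j < s) (i : Fin k) (l : List Bool) (hl : l.length + 1 < s) :
    Relation.ReflTransGen ((clearTape i).Step w s)
      (Sum.inl true, T.setTape i (readInput l) l.length)
      (Sum.inr (), T.setTape i (readInput []) 1) := by
  induction l using List.reverseRecOn with
  | nil =>
    refine .single ?_
    have h := step_onTape (F := clearTape i) hT hs (f := readInput []) (p := 0) (q := true)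
      (q' := Sum.inr ()) (x := .leftEnd) (m := .right) (i := i)
      (fun z y hy => by
        change y i = InputSymbol.leftEnd at hy
        simp [clearTape, hy]) (by simp [TuringTransducer.moveHead]; simpa using hl)
    have h' : Function.update (readInput []) 0 InputSymbol.leftEnd = readInput [] :=
      Function.update_eq_self 0 (readInput [])
    rwa [h'] at h
  | append_singleton l b ih =>
    rw [List.length_append, List.length_singleton] at hl ⊢
    have h := step_onTape (F := clearTape i) hT hs (f := readInput (l ++ [b]))
      (p := l.length + 1) (q := true)
      (q' := Sum.inl true) (x := .rightEnd) (m := .left) (i := i)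
      (fun z y hy => by
        rw [readInput_append_cons] at hy
        simp [clearTape, hy]) (by simp [TuringTransducer.moveHead]; lia)
    rw [update_readInput_concat] at h
    exact .head h (ih (by lia))

theorem steps_clearTape {T : Tapes k} (hT : T.inputPos ≤ w.length + 1)
    (hs : ∀ j, T.workPos j < s) (i : Fin k) (suf pre : List Bool)
    (hl : (pre ++ suf).length + 1 < s) :
    Relation.ReflTransGen ((clearTape i).Step w s)
      (Sum.inl false, T.setTape i (readInput (pre ++ suf)) (pre.length + 1))
      (Sum.inr (), T.setTape i (readInput []) 1) := by
  induction suf generalizing pre with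
  | nil =>
    rw [List.append_nil] at hl ⊢
    have h := step_onTape (F := clearTape i) hT hs (f := readInput pre) (p := pre.length + 1)
      (q := false) (q' := Sum.inl true) (x := .rightEnd) (m := .left) (i := i)
      (fun z y hy => by
        rw [readInput_length] at hy
        simp [clearTape, hy]) (by simp [TuringTransducer.moveHead]; lia)
    rw [← readInput_length pre, Function.update_eq_self] at h
    exact .head h (steps_clearTape_back hT hs i pre hl)
  | cons b suf ih =>
    have hl' := hl
    rw [List.length_append, List.length_cons] at hl'
    have h := step_onTape (F := clearTape i) hT hs (f := readInput (pre ++ b :: suf))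
      (p := pre.length + 1) (q := false) (q' := Sum.inl false) (x := .bit b) (m := .right)
      (i := i)
      (fun z y hy => by
        rw [readInput_append_cons] at hy
        simp [clearTape, hy]) (by simp [TuringTransducer.moveHead]; lia)
    rw [update_readInput] at h
    have ih' := ih (pre ++ [b]) (by simp; lia)
    simp only [List.append_assoc, List.singleton_append, List.length_append,
      List.length_singleton] at ih'
    exact .head h ih'

/-- Moving the heads of two work tapes. -/
def onHeads (i j : Fin k) (y : Fin k → InputSymbol) (m : HeadMove) : TapeAction k :=
  (HeadMove.stay, fun t => (y t, if t = i ∨ t = j then m else HeadMove.stay), none)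

/-- Placing the heads of two work tapes. -/
def _root_.Tapes.setHeads (T : Tapes k) (i j : Fin k) (p : ℕ) : Tapes k :=
  { T with workPos := fun t => if t = i ∨ t = j then p else T.workPos t }

theorem act_onHeads {T : Tapes k} (hT : T.inputPos ≤ w.length + 1) (i j : Fin k) (p : ℕ)
    (m : HeadMove) :
    (T.setHeads i j p).act w (onHeads i j
      (fun t => (T.setHeads i j p).work t ((T.setHeads i j p).workPos t)) m) =
    T.setHeads i j (TuringTransducer.moveHead m p) := by
  ext t
  · simp [Tapes.act, Tapes.setHeads, onHeads, TuringTransducer.moveHead, hT]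
  · simp [Tapes.act, Tapes.setHeads, onHeads]
  · simp only [Tapes.act, Tapes.setHeads, onHeads]
    split_ifs <;> rfl
  · simp [Tapes.act, Tapes.setHeads, onHeads]

theorem step_onHeads {F : Fragment k E} {T : Tapes k} (hT : T.inputPos ≤ w.length + 1)
    (hs : ∀ t, T.workPos t < s) {i j : Fin k} {p : ℕ}
    {m : HeadMove} {q : F.State} {q' : F.State ⊕ E}
    (h : ∀ z y, y i = T.work i p → y j = T.work j p → F.next q z y = (q', onHeads i j y m))
    (hm : TuringTransducer.moveHead m p < s) :
    F.Step w s (Sum.inl q, T.setHeads i j p)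
      (q', T.setHeads i j (TuringTransducer.moveHead m p)) := by
  rw [← act_onHeads hT]
  refine .mk _ _ _ _ (h _ _ (by simp [Tapes.setHeads]) (by simp [Tapes.setHeads])) fun t => ?_
  rw [act_onHeads hT]
  simp only [Tapes.setHeads]
  split_ifs
  · exact hm
  · exact hs t

/-- Comparing two work tapes. On its way back, the machine is in one of the states `some b`, where
`b` is the result. -/
def eqTape (i j : Fin k) : Fragment k Bool where
  State := Option Bool
  start := none
  next q _ y := match q with
    | none => match y i, y j with
      | .bit true, .bit true => (Sum.inl none, onHeads i j y .right)
      | .bit false, .bit false => (Sum.inl none, onHeads i j y .right)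
      | .rightEnd, .rightEnd => (Sum.inl (some true), onHeads i j y .left)
      | _, _ => (Sum.inl (some false), onHeads i j y .left)
    | some b => match y i with
      | .leftEnd => (Sum.inr b, onHeads i j y .right)
      | _ => (Sum.inl (some b), onHeads i j y .left)

/-- Both heads move in parallel, so tape `i` alone tells when to stop. -/
theorem steps_eqTape_back {T : Tapes k} (hT : T.inputPos ≤ w.length + 1)
    (hs : ∀ t, T.workPos t < s) (i j : Fin k) (b : Bool) (l : List Bool)
    (hi : T.work i = readInput l) (hl : l.length + 1 < s) (p : ℕ) (hp : p ≤ l.length) :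
    Relation.ReflTransGen ((eqTape i j).Step w s)
      (Sum.inl (some b), T.setHeads i j p) (Sum.inr b, T.setHeads i j 1) := by
  induction p with
  | zero =>
    refine .single (step_onHeads (m := .right) hT hs (fun z y hy _ => ?_) ?_)
    · rw [hi] at hy
      change y i = InputSymbol.leftEnd at hy
      simp [eqTape, hy]
    · simp [TuringTransducer.moveHead]; lia
  | succ p ih =>
    refine .head (step_onHeads (m := .left) (q' := Sum.inl (some b)) hT hs (fun z y hy _ => ?_) ?_)
      (ih (by lia))
    · rw [hi, readInput_of_le l hp] at hy
      simp [eqTape, hy]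
    · simp [TuringTransducer.moveHead]; lia

/-- The strings agree on the prefix `pre` that has been scanned. The heads turn back at the first
difference, at the latest at the blank behind tape `i`, so the length of tape `j` does not enter the
space bound. -/
theorem steps_eqTape {T : Tapes k} (hT : T.inputPos ≤ w.length + 1)
    (hs : ∀ t, T.workPos t < s) (i j : Fin k) (l l' pre : List Bool)
    (hi : T.work i = readInput (pre ++ l)) (hj : T.work j = readInput (pre ++ l'))
    (hl : (pre ++ l).length + 1 < s) :
    Relation.ReflTransGen ((eqTape i j).Step w s)
      (Sum.inl none, T.setHeads i j (pre.length + 1))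
      (Sum.inr (decide (l = l')), T.setHeads i j 1) := by
  have hl' := hl
  rw [List.length_append] at hl'
  induction l generalizing l' pre with
  | nil =>
    refine .head (step_onHeads (m := .left) (q' := Sum.inl (some (decide ([] = l')))) hT hs
      (fun z y hy hy' => ?_) (by simp [TuringTransducer.moveHead]; lia))
      (steps_eqTape_back hT hs i j _ _ hi hl _ (by simp [TuringTransducer.moveHead]))
    rw [hi, List.append_nil, readInput_length] at hy
    rw [hj] at hy'
    cases l' with
    | nil =>
      rw [List.append_nil, readInput_length] at hy'
      simp [eqTape, hy, hy']
    | cons b l' =>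
      rw [readInput_append_cons] at hy'
      simp [eqTape, hy, hy']
  | cons b l ih =>
    rw [List.length_cons] at hl'
    by_cases h : ∃ l'', l' = b :: l''
    · obtain ⟨l'', rfl⟩ := h
      have ih' := ih l'' (pre ++ [b]) (by simpa using hi) (by simpa using hj) (by simp; lia)
        (by simp; lia)
      simp only [List.length_append, List.length_singleton] at ih'
      simp only [List.cons.injEq, true_and]
      refine .head (step_onHeads (m := .right) (q' := Sum.inl none) hT hs
        (fun z y hy hy' => ?_) (by simp [TuringTransducer.moveHead]; lia)) ih'
      rw [hi, readInput_append_cons] at hy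
      rw [hj, readInput_append_cons] at hy'
      cases b <;> simp [eqTape, hy, hy']
    · have hne : decide (b :: l = l') = false := by
        rw [decide_eq_false_iff_not]
        rintro rfl
        exact h ⟨l, rfl⟩
      rw [hne]
      refine .head (step_onHeads (m := .left) (q' := Sum.inl (some false)) hT hs
        (fun z y hy hy' => ?_) (by simp [TuringTransducer.moveHead]; lia))
        (steps_eqTape_back hT hs i j _ _ hi hl _ (by simp [TuringTransducer.moveHead]))
      rw [hi, readInput_append_cons] at hy
      rw [hj] at hy'
      cases l' with
      | nil =>
        rw [List.append_nil, readInput_length] at hy'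
        cases b <;> simp [eqTape, hy, hy']
      | cons b' l' =>
        rw [readInput_append_cons] at hy'
        cases b <;> cases b' <;> simp_all [eqTape]

end Fragment

/-! ### Register machines -/

/-- The work tapes hold the registers `r 0, …, r (k - 1)` in binary, behind an end marker. -/
def registerTapes (k : ℕ) (r : ℕ → ℕ) (p : ℕ) (o : List Bool) : Tapes k :=
  ⟨p, fun i => readInput (r i).bits, fun _ => 1, o⟩

namespace Fragment

variable {k : ℕ} {E E' : Type} {w : List Bool} {s : ℕ}

theorem setTape_registerTapes (r : ℕ → ℕ) (p : ℕ) (o : List Bool) (i : Fin k) (v : ℕ) :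
    (registerTapes k r p o).setTape i (readInput v.bits) 1 =
      registerTapes k (Function.update r i v) p o := by
  ext j
  · rfl
  · rcases eq_or_ne j i with rfl | hj
    · simp [registerTapes, Tapes.setTape]
    · have : (j : ℕ) ≠ i := fun h => hj (Fin.ext h)
      simp [registerTapes, Tapes.setTape, hj, this]
  · simp only [registerTapes, Tapes.setTape, Function.update_apply]
    split_ifs <;> rfl
  · rfl

theorem setTape_registerTapes_self (r : ℕ → ℕ) (p : ℕ) (o : List Bool) (i : Fin k) :
    (registerTapes k r p o).setTape i (readInput (r i).bits) 1 = registerTapes k r p o := by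
  rw [setTape_registerTapes, Function.update_eq_self]

/-- Leaving through the exit `e`. -/
def exit (e : E) : Fragment k E := single fun _ => (e, HeadMove.stay, none)

theorem runs_exit (e : E) (hs : 1 < s) {r : ℕ → ℕ} {p : ℕ} (hp : p ≤ w.length + 1)
    {o : List Bool} : (exit (k := k) e).Runs w s (registerTapes k r p o) e
      (registerTapes k r p o) := by
  have h := runs_single (w := w) (fun _ => (e, HeadMove.stay, none))
    (T := registerTapes k r p o) (s := s) (fun _ => hs) rfl
  simpa [exit, registerTapes, TuringTransducer.moveHead, hp] using h

/-- Appending a bit to the output. -/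
def write (b : Bool) : Fragment k Unit := single fun _ => ((), HeadMove.stay, some b)

theorem runs_write (b : Bool) (hs : 1 < s) {r : ℕ → ℕ} {p : ℕ} (hp : p ≤ w.length + 1)
    {o : List Bool} : (write (k := k) b).Runs w s (registerTapes k r p o) ()
      (registerTapes k r p (o ++ [b])) := by
  have h := runs_single (w := w) (fun _ => ((), HeadMove.stay, some b))
    (T := registerTapes k r p o) (s := s) (fun _ => hs) rfl
  simpa [write, registerTapes, TuringTransducer.moveHead, hp] using h

/-- Reading a symbol from the input and moving to the right. -/
def read : Fragment k InputSymbol := single fun x => (x, HeadMove.right, none)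

theorem runs_read (hs : 1 < s) {r : ℕ → ℕ} {p : ℕ} {o : List Bool} :
    (read (k := k)).Runs w s (registerTapes k r p o) (readInput w p)
      (registerTapes k r (min (p + 1) (w.length + 1)) o) := by
  have h := runs_single (w := w) (fun x => (x, HeadMove.right, none))
    (T := registerTapes k r p o) (s := s) (fun _ => hs) rfl
  simpa [read, registerTapes, TuringTransducer.moveHead] using h

/-- Moving the input head back to the left end. -/
def rewind : Fragment k Unit :=
  loop (single fun x => match x with
    | .leftEnd => (some (), HeadMove.stay, none)
    | _ => (none, HeadMove.left, none))

theorem runs_rewind (hs : 1 < s) {r : ℕ → ℕ} {p : ℕ} (hp : p ≤ w.length + 1) {o : List Bool} :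
    (rewind (k := k)).Runs w s (registerTapes k r p o) () (registerTapes k r 0 o) := by
  induction p with
  | zero =>
    refine Runs.loop_exit ?_
    have h := runs_single (w := w) (fun x => match x with
      | .leftEnd => (some (), HeadMove.stay, none)
      | _ => (none, HeadMove.left, none)) (T := registerTapes k r 0 o) (s := s) (fun _ => hs) rfl
    simpa [registerTapes, TuringTransducer.moveHead] using h
  | succ p ih =>
    refine Runs.loop_again ?_ (ih (by lia))
    have h := runs_single (w := w) (fun x => match x with
      | .leftEnd => (some (), HeadMove.stay, none)
      | _ => (none, HeadMove.left, none)) (T := registerTapes k r (p + 1) o) (s := s)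
      (fun _ => hs) (e := none) (m := .left) (o := none) (by
        simp only [registerTapes, readInput]
        cases w[p]? <;> rfl)
    have hp' : min p (w.length + 1) = p := by lia
    simpa [registerTapes, TuringTransducer.moveHead, hp'] using h

/-! ### Register operations, bounded loops and random access to the input. -/

variable [NeZero k] {B : ℕ}

/-- Incrementing the register `i`. -/
def inc (i : ℕ) : Fragment k Unit := incTape (Fin.ofNat k i)

/-- Setting the register `i` to zero. -/
def clear (i : ℕ) : Fragment k Unit := clearTape (Fin.ofNat k i)

/-- Comparing the registers `i` and `j`. -/
def eqTest (i j : ℕ) : Fragment k Bool := eqTape (Fin.ofNat k i) (Fin.ofNat k j)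

theorem val_ofNat {i : ℕ} (hi : i < k) : (Fin.ofNat k i : ℕ) = i := Nat.mod_eq_of_lt hi

/-- A register bounded by `B` has at most `B.size` bits. The same inequality `B.size + 2 < s` serves
as the space bound for all register operations. -/
theorem runs_inc {i : ℕ} (hi : i < k) {r : ℕ → ℕ} (hr : r i ≤ B) (hB : B.size + 2 < s) {p : ℕ}
    (hp : p ≤ w.length + 1) {o : List Bool} :
    (inc (k := k) i).Runs w s (registerTapes k r p o) ()
      (registerTapes k (Function.update r i (r i + 1)) p o) := by
  have h := steps_incTape (w := w) (s := s) (T := registerTapes k r p o) hp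
    (fun _ => by simp only [registerTapes]; lia) (Fin.ofNat k i) (r i).bits [] (by
      have := Nat.size_le_size hr
      rw [List.nil_append, Nat.size_eq_bits_len]; lia)
  rw [List.nil_append, List.nil_append, ← bits_succ, setTape_registerTapes] at h
  have h' := setTape_registerTapes_self r p o (Fin.ofNat k i)
  rw [val_ofNat hi] at h h'
  rw [List.length_nil, zero_add, h'] at h
  exact h

theorem runs_clear {i : ℕ} (hi : i < k) {r : ℕ → ℕ} (hr : r i ≤ B) (hB : B.size + 2 < s) {p : ℕ}
    (hp : p ≤ w.length + 1) {o : List Bool} :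
    (clear (k := k) i).Runs w s (registerTapes k r p o) ()
      (registerTapes k (Function.update r i 0) p o) := by
  have h := steps_clearTape (w := w) (s := s) (T := registerTapes k r p o) hp
    (fun _ => by simp only [registerTapes]; lia) (Fin.ofNat k i) (r i).bits [] (by
      have := Nat.size_le_size hr
      rw [List.nil_append, Nat.size_eq_bits_len]; lia)
  rw [List.nil_append, ← Nat.zero_bits, setTape_registerTapes, Nat.zero_bits] at h
  have h' := setTape_registerTapes_self r p o (Fin.ofNat k i)
  rw [val_ofNat hi] at h h'
  rw [List.length_nil, zero_add, h'] at h
  exact h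

theorem runs_eqTest {i j : ℕ} (hi : i < k) (hj : j < k) {r : ℕ → ℕ} (hr : r i ≤ B)
    (hB : B.size + 2 < s) {p : ℕ} (hp : p ≤ w.length + 1) {o : List Bool} :
    (eqTest (k := k) i j).Runs w s (registerTapes k r p o) (decide (r i = r j))
      (registerTapes k r p o) := by
  have h := steps_eqTape (w := w) (s := s) (T := registerTapes k r p o) hp
    (fun _ => by simp only [registerTapes]; lia) (Fin.ofNat k i) (Fin.ofNat k j)
    (r i).bits (r j).bits [] (by simp only [registerTapes, val_ofNat hi]; rfl)
    (by simp only [registerTapes, val_ofNat hj]; rfl) (by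
      have := Nat.size_le_size hr
      rw [List.nil_append, Nat.size_eq_bits_len]; lia)
  have h' : (registerTapes k r p o).setHeads (Fin.ofNat k i) (Fin.ofNat k j) 1 =
      registerTapes k r p o := by
    simp [Tapes.setHeads, registerTapes]
  rw [List.length_nil, zero_add, h', decide_eq_decide.2 bits_injective.eq_iff] at h
  exact h

/-- Executing `F` with the values `0, 1, …` in register `i`, as long as this is not the value of
the register `j`. -/
def forLoop (i j : ℕ) (F : Fragment k Unit) : Fragment k Unit :=
  (clear i).bind fun _ => loop ((eqTest i j).bind fun b =>
    if b then exit (some ()) else F.bind fun _ => (inc i).bind fun _ => exit none)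

/-- Loop rule: `I x r o` is the invariant before the pass with counter value `x`. The body has to
preserve the counter and to bring the input head back to position `0`; the invariant is restored
after the counter is incremented. -/
theorem runs_forLoop {i j : ℕ} (hi : i < k) (hj : j < k) (hB : B.size + 2 < s)
    {F : Fragment k Unit} {n : ℕ} (hn : n ≤ B) (I : ℕ → (ℕ → ℕ) → List Bool → Prop)
    (hI : ∀ x r o, I x r o → r i = x ∧ r j = n)
    (hF : ∀ x < n, ∀ r o, I x r o → ∃ r' o',
      F.Runs w s (registerTapes k r 0 o) () (registerTapes k r' 0 o') ∧ r' i = x ∧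
        I (x + 1) (Function.update r' i (x + 1)) o')
    {r : ℕ → ℕ} {o : List Bool} (hr : r i ≤ B) (h0 : I 0 (Function.update r i 0) o) :
    ∃ r' o', (forLoop i j F).Runs w s (registerTapes k r 0 o) () (registerTapes k r' 0 o') ∧
      I n r' o' := by
  -- Induction on the number `d` of passes that remain.
  have key : ∀ d x r o, x + d = n → I x r o → ∃ r' o',
      (loop ((eqTest i j).bind fun b => if b then exit (some ()) else
        F.bind fun _ => (inc i).bind fun _ => exit none)).Runs w s
        (registerTapes k r 0 o) () (registerTapes k r' 0 o') ∧ I n r' o' := by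
    intro d
    induction d with
    | zero =>
      intro x r o hx h
      obtain ⟨h1, h2⟩ := hI x r o h
      refine ⟨r, o, Runs.loop_exit (Runs.bind (runs_eqTest hi hj (by lia) hB (by lia)) ?_), ?_⟩
      · have : r i = r j := by lia
        simp only [this, decide_true, if_true]
        exact runs_exit _ (by lia) (by lia)
      · obtain rfl : x = n := by lia
        exact h
    | succ d ih =>
      intro x r o hx h
      obtain ⟨h1, h2⟩ := hI x r o h
      obtain ⟨r', o', hrun, hr', h'⟩ := hF x (by lia) r o h
      obtain ⟨r'', o'', hrun', h''⟩ := ih (x + 1) _ _ (by lia) h'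
      refine ⟨r'', o'', Runs.loop_again
        (Runs.bind (runs_eqTest hi hj (B := B) (by lia) hB (by lia)) ?_) hrun', h''⟩
      have : r i ≠ r j := by lia
      simp only [this, decide_false, Bool.false_eq_true, if_false]
      refine hrun.bind ?_
      have hinc := runs_inc (B := B) hi (r := r') (by lia) hB (p := 0) (w := w) (by lia) (o := o')
      rw [hr'] at hinc
      exact hinc.bind (runs_exit _ (by lia) (by lia))
  obtain ⟨r', o', h, h'⟩ := key n 0 _ _ (by lia) h0
  exact ⟨r', o', (runs_clear hi hr hB (by lia)).bind h, h'⟩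

/-- Adding the register `j` to the register `i`, by means of the register `t`. -/
def addTo (i j t : ℕ) : Fragment k Unit := forLoop t j (inc i)

theorem runs_addTo {i j t : ℕ} (hi : i < k) (hj : j < k) (ht : t < k) (hij : i ≠ j) (hit : i ≠ t)
    (hjt : j ≠ t) (hB : B.size + 2 < s) {r : ℕ → ℕ} (hr : ∀ l, r l ≤ B) (h : r i + r j ≤ B)
    {o : List Bool} : ∃ r', (addTo (k := k) i j t).Runs w s (registerTapes k r 0 o) ()
      (registerTapes k r' 0 o) ∧ (∀ l, r' l ≤ B) ∧ r' i = r i + r j ∧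
      ∀ l, l ≠ i → l ≠ t → r' l = r l := by
  -- Invariant: after `x` passes register `i` has grown by `x`, and apart from the counter `t`
  -- nothing else has changed.
  obtain ⟨r', o', h1, h2, -, h3, h4, rfl⟩ := runs_forLoop (F := inc i) (w := w) ht hj hB (hr j)
    (fun x r' o' => r' t = x ∧ x ≤ r j ∧ r' i = r i + x ∧ (∀ l, l ≠ i → l ≠ t → r' l = r l) ∧ o' = o)
    (fun x r' o' h => ⟨h.1, h.2.2.2.1 j hij.symm hjt⟩)
    (fun x hx r' o' ⟨h1, h2, h3, h4, h5⟩ => ⟨_, _, runs_inc hi (B := B) (by lia) hB (by lia),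
      by rw [Function.update_of_ne hit.symm, h1], by simp, hx, by simp [hit, h3, add_assoc],
      fun l hl hl' => by simp [hl, hl', h4 l hl hl'], h5⟩)
    (hr t) (o := o)
    ⟨by simp, by lia, by simp [hit], fun l hl hl' => by simp [hl'], rfl⟩
  refine ⟨r', h1, fun l => ?_, h3, h4⟩
  by_cases hl : l = i
  · subst hl; lia
  · by_cases hl' : l = t
    · subst hl'; rw [h2]; exact hr j
    · rw [h4 l hl hl']; exact hr l

/-- Skipping numbers on the input tape until the value of the register `c`, which is incremented
with each of them, has reached that of `q`. -/
def skipNats (q c : ℕ) : Fragment k Unit :=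
  loop ((eqTest c q).bind fun b => if b then exit (some ()) else read.bind fun x =>
    match x with
    | .bit true => exit none
    | .bit false => (inc c).bind fun _ => exit none
    | _ => exit (some ()))

/-- Adding the next number on the input tape to the register `z`. -/
def countOnes (z : ℕ) : Fragment k Unit :=
  loop (read.bind fun x =>
    match x with
    | .bit true => (inc z).bind fun _ => exit none
    | _ => exit (some ()))

theorem _root_.encodeNats_zero_cons (N : List ℕ) :
    encodeNats (0 :: N) = false :: encodeNats N := rfl

theorem _root_.encodeNats_succ_cons (x : ℕ) (N : List ℕ) :
    encodeNats ((x + 1) :: N) = true :: encodeNats (x :: N) := rfl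

/-- `d` is the number of entries still to be skipped, and the input head stands just behind `pre`.
If the input ends too early, the head stays at the right end marker, in accordance with `N.drop d =
[]`; the final value of `c` is then not `r q`, so it is only bounded. -/
theorem runs_skipNats {q c : ℕ} (hq : q < k) (hc : c < k) (hqc : q ≠ c) (hB : B.size + 2 < s)
    {o : List Bool} (d : ℕ) (N : List ℕ) (pre : List Bool) (hw : w = pre ++ encodeNats N)
    (r : ℕ → ℕ) (hr : r q ≤ B) (hd : r c + d = r q) :
    ∃ c' ≤ B, ∃ pre', w = pre' ++ encodeNats (N.drop d) ∧
      (skipNats (k := k) q c).Runs w s (registerTapes k r (pre.length + 1) o) ()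
        (registerTapes k (Function.update r c c') (pre'.length + 1) o) := by
  induction d generalizing N pre r with
  | zero =>
    refine ⟨r c, by lia, pre, hw, ?_⟩
    rw [Function.update_eq_self]
    have hp : pre.length + 1 ≤ w.length + 1 := by simp [hw]
    refine Runs.loop_exit (Runs.bind (runs_eqTest hc hq (B := B) (by lia) hB hp) ?_)
    have : r c = r q := by lia
    simp only [this, decide_true, if_true]
    exact runs_exit _ (by lia) hp
  | succ d ih =>
    have hne : r c ≠ r q := by lia
    cases N with
    | nil =>
      refine ⟨r c, by lia, pre, hw, ?_⟩
      rw [Function.update_eq_self]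
      have hw' : w = pre := by simpa [encodeNats] using hw
      subst hw'
      refine Runs.loop_exit (Runs.bind (runs_eqTest hc hq (B := B) (by lia) hB (by lia)) ?_)
      simp only [hne, decide_false, Bool.false_eq_true, if_false]
      refine (runs_read (by lia)).bind ?_
      rw [readInput_length, min_eq_right (by lia)]
      exact runs_exit _ (by lia) (by lia)
    | cons x N =>
      rw [List.drop_succ_cons]
      -- Inner induction on the ones left in the current number; only its terminating zero advances
      -- the counter `c`.
      induction x generalizing pre with
      | zero =>
        rw [encodeNats_zero_cons] at hw
        obtain ⟨c', hc', pre', hw', h'⟩ := ih N (pre ++ [false]) (by simpa using hw)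
          (Function.update r c (r c + 1)) (by rwa [Function.update_of_ne hqc])
          (by simp [Function.update_of_ne hqc]; lia)
        rw [Function.update_idem, List.length_append, List.length_singleton] at h'
        refine ⟨c', hc', pre', hw', Runs.loop_again
          (Runs.bind (runs_eqTest hc hq (B := B) (by lia) hB (by simp [hw])) ?_) h'⟩
        simp only [hne, decide_false, Bool.false_eq_true, if_false]
        refine (runs_read (by lia)).bind ?_
        have hlen : pre.length + 1 + 1 ≤ w.length + 1 := by simp [hw]
        have hread : readInput w (pre.length + 1) = .bit false := by
          rw [hw, readInput_append_cons]
        rw [hread, min_eq_left hlen]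
        exact (runs_inc hc (B := B) (by lia) hB hlen).bind (runs_exit _ (by lia) hlen)
      | succ x ihx =>
        rw [encodeNats_succ_cons] at hw
        obtain ⟨c', hc', pre', hw', h'⟩ := ihx (pre ++ [true]) (by simpa using hw)
        rw [List.length_append, List.length_singleton] at h'
        refine ⟨c', hc', pre', hw', Runs.loop_again
          (Runs.bind (runs_eqTest hc hq (B := B) (by lia) hB (by simp [hw])) ?_) h'⟩
        simp only [hne, decide_false, Bool.false_eq_true, if_false]
        refine (runs_read (by lia)).bind ?_
        have hlen : pre.length + 1 + 1 ≤ w.length + 1 := by simp [hw]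
        have hread : readInput w (pre.length + 1) = .bit true := by
          rw [hw, readInput_append_cons]
        rw [hread, min_eq_left hlen]
        exact runs_exit _ (by lia) hlen

/-- At the end of the input nothing is added, which matches the default value `0`. The final head
position is left open, as the input head is rewound afterwards. -/
theorem runs_countOnes {z : ℕ} (hz : z < k) (hB : B.size + 2 < s) {o : List Bool} (N : List ℕ)
    (pre : List Bool) (hw : w = pre ++ encodeNats N) (r : ℕ → ℕ) (hr : r z + N.headD 0 ≤ B) :
    ∃ p ≤ w.length + 1,
      (countOnes (k := k) z).Runs w s (registerTapes k r (pre.length + 1) o) ()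
        (registerTapes k (Function.update r z (r z + N.headD 0)) p o) := by
  cases N with
  | nil =>
    have hw' : w = pre := by simpa [encodeNats] using hw
    subst hw'
    refine ⟨w.length + 1, le_rfl, Runs.loop_exit ((runs_read (by lia)).bind ?_)⟩
    rw [readInput_length, min_eq_right (by lia), List.headD_nil, add_zero,
      Function.update_eq_self]
    exact runs_exit _ (by lia) (by lia)
  | cons x N =>
    rw [List.headD_cons] at hr ⊢
    induction x generalizing pre r with
    | zero =>
      rw [encodeNats_zero_cons] at hw
      have hlen : pre.length + 1 + 1 ≤ w.length + 1 := by simp [hw]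
      have hread : readInput w (pre.length + 1) = .bit false := by
        rw [hw, readInput_append_cons]
      refine ⟨_, hlen, Runs.loop_exit ((runs_read (by lia)).bind ?_)⟩
      rw [hread, min_eq_left hlen, add_zero, Function.update_eq_self]
      exact runs_exit _ (by lia) hlen
    | succ x ih =>
      rw [encodeNats_succ_cons] at hw
      have hlen : pre.length + 1 + 1 ≤ w.length + 1 := by simp [hw]
      have hread : readInput w (pre.length + 1) = .bit true := by
        rw [hw, readInput_append_cons]
      obtain ⟨p, hp, h⟩ := ih (pre ++ [true]) (Function.update r z (r z + 1))
        (by simpa using hw) (by simp; lia)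
      rw [Function.update_idem, Function.update_self, List.length_append,
        List.length_singleton, show r z + 1 + x = r z + (x + 1) by lia] at h
      refine ⟨p, hp, Runs.loop_again ((runs_read (by lia)).bind ?_) h⟩
      rw [hread, min_eq_left hlen]
      exact (runs_inc hz (B := B) (by lia) hB hlen).bind (runs_exit _ (by lia) hlen)

/-- Looking up the number on the input tape whose index is in the register `q`, by means of the
register `c`; the result goes into the register `z`. -/
def fetch (z q c : ℕ) : Fragment k Unit :=
  (clear z).bind fun _ => (clear c).bind fun _ => read.bind fun _ => (skipNats q c).bind fun _ =>
    (countOnes z).bind fun _ => rewind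

/-- The entry with index `r q` is the head of the list after `r q` entries have been dropped. The
single `read` beforehand passes the left end marker. -/
theorem runs_fetch {z q c : ℕ} (hz : z < k) (hq : q < k) (hc : c < k) (hzq : z ≠ q) (hzc : z ≠ c)
    (hqc : q ≠ c) (hB : B.size + 2 < s) {N : List ℕ} (hN : ∀ x ∈ N, x ≤ B)
    (hw : w = encodeNats N) {r : ℕ → ℕ} (hr : ∀ l, r l ≤ B) {o : List Bool} :
    ∃ r', (fetch (k := k) z q c).Runs w s (registerTapes k r 0 o) () (registerTapes k r' 0 o) ∧
      (∀ l, r' l ≤ B) ∧ r' z = N.getD (r q) 0 ∧ ∀ l, l ≠ z → l ≠ c → r' l = r l := by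
  have hget : (N.drop (r q)).headD 0 = N.getD (r q) 0 := by
    rw [List.headD_eq_head?_getD, List.head?_drop, List.getD_eq_getElem?_getD]
  have hget' : N.getD (r q) 0 ≤ B := by
    rw [List.getD_eq_getElem?_getD]
    rcases h : N[r q]? with _ | x
    · simp
    · exact hN x (List.mem_of_getElem? h)
  obtain ⟨c', hc', pre', hw', h₁⟩ := runs_skipNats (w := w) (o := o) hq hc hqc hB (r q) N [] hw
    (Function.update (Function.update r z 0) c 0) (by simp [hqc, hzq.symm, hr])
    (by simp [hqc, hzq.symm])
  obtain ⟨p, hp, h₂⟩ := runs_countOnes (o := o) hz hB _ _ hw'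
    (Function.update (Function.update (Function.update r z 0) c 0) c c')
    (by rw [hget]; simpa [hzc] using hget')
  refine ⟨_, (runs_clear hz (hr z) hB (by lia)).bind ((runs_clear hc (B := B) ?_ hB
    (by lia)).bind ((runs_read (by lia)).bind (h₁.bind (h₂.bind (runs_rewind (by lia) hp))))),
    ?_, ?_, ?_⟩
  · simp [hzc.symm, hr]
  · intro l
    rw [hget]
    simp only [Function.update_apply]
    split_ifs <;> simp_all
  · rw [hget]
    simp [hzc]
  · intro l hl hl'
    simp [hl, hl']

end Fragment

/-! ### A programming language for logarithmic space -/

/-- Arithmetic expressions; `get e` is the number with index `e` in the input. -/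
inductive NatExpr : Type where
  | var (i : ℕ)
  | zero
  | succ (e : NatExpr)
  | add (e f : NatExpr)
  | mul (e f : NatExpr)
  | eq (e f : NatExpr)
  | get (e : NatExpr)

namespace NatExpr

/-- The value of an expression on the input `N`. -/
def eval (N : List ℕ) (v : ℕ → ℕ) : NatExpr → ℕ
  | var i => v i
  | zero => 0
  | succ e => e.eval N v + 1
  | add e f => e.eval N v + f.eval N v
  | mul e f => e.eval N v * f.eval N v
  | eq e f => if e.eval N v = f.eval N v then 1 else 0
  | get e => N.getD (e.eval N v) 0

/-- All variables have numbers below `t`. -/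
def Scoped (t : ℕ) : NatExpr → Prop
  | var i => i < t
  | zero => True
  | succ e => e.Scoped t
  | add e f => e.Scoped t ∧ f.Scoped t
  | mul e f => e.Scoped t ∧ f.Scoped t
  | eq e f => e.Scoped t ∧ f.Scoped t
  | get e => e.Scoped t

/-- The number of registers that suffice for the evaluation of an expression. -/
def width : NatExpr → ℕ
  | var _ => 2
  | zero => 1
  | succ e => e.width + 1
  | add e f => e.width + f.width + 3
  | mul e f => e.width + f.width + 5
  | eq e f => e.width + f.width + 3
  | get e => e.width + 3

/-- The value of the expression is at most `b ^ deg d e`, if the input numbers are at most `b` and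
the values of the variables are at most `b ^ d`. -/
def deg (d : ℕ) : NatExpr → ℕ
  | var _ => d
  | zero => 0
  | succ e => e.deg d + 1
  | add e f => e.deg d + f.deg d + 1
  | mul e f => e.deg d + f.deg d
  | eq e f => e.deg d + f.deg d
  | get e => e.deg d + 1

/-- Sums are bounded through `x + y ≤ b * x * y` for `x, y ≥ 1` and `b ≥ 2`, which accounts for the
extra `1` in the degree. A looked-up value is at most `b`, whatever its index. -/
theorem eval_le (e : NatExpr) {N : List ℕ} {v : ℕ → ℕ} {b d : ℕ} (hb : 2 ≤ b)
    (hN : ∀ x ∈ N, x ≤ b) (hv : ∀ i, v i ≤ b ^ d) : e.eval N v ≤ b ^ e.deg d := by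
  induction e with
  | var i => exact hv i
  | zero => exact Nat.zero_le _
  | succ e ih =>
    have := Nat.one_le_pow (e.deg d) b (by lia)
    simp only [eval, deg, pow_succ]
    nlinarith
  | add e f ihe ihf =>
    have h1 := Nat.one_le_pow (e.deg d) b (by lia)
    have h2 := Nat.one_le_pow (f.deg d) b (by lia)
    have h3 : b ^ e.deg d ≤ b ^ e.deg d * b ^ f.deg d := Nat.le_mul_of_pos_right _ h2
    have h4 : b ^ f.deg d ≤ b ^ e.deg d * b ^ f.deg d := Nat.le_mul_of_pos_left _ h1
    simp only [eval, deg, pow_succ, pow_add]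
    nlinarith
  | mul e f ihe ihf =>
    simp only [eval, deg, pow_add]
    exact Nat.mul_le_mul ihe ihf
  | eq e f ihe ihf =>
    have := Nat.one_le_pow ((e.eq f).deg d) b (by lia)
    simp only [eval]
    split_ifs <;> lia
  | get e ih =>
    have h1 : N.getD (e.eval N v) 0 ≤ b := by
      rw [List.getD_eq_getElem?_getD]
      rcases h : N[e.eval N v]? with _ | x
      · simp
      · exact hN x (List.mem_of_getElem? h)
    exact h1.trans (Nat.le_self_pow (Nat.succ_ne_zero _) b)

open Fragment

/-- Evaluating an expression with variables in the registers below `t`; the result goes into the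
register `t`. -/
def compile {k : ℕ} [NeZero k] : NatExpr → ℕ → Fragment k Unit
  | var i, t => (clear t).bind fun _ => addTo t i (t + 1)
  | zero, t => clear t
  | succ e, t => (e.compile t).bind fun _ => inc t
  | add e f, t => (e.compile t).bind fun _ => (f.compile (t + 1)).bind fun _ =>
      addTo t (t + 1) (t + 2)
  | mul e f, t => (e.compile (t + 1)).bind fun _ => (f.compile (t + 2)).bind fun _ =>
      (clear t).bind fun _ => forLoop (t + 3) (t + 1) (addTo t (t + 2) (t + 4))
  | eq e f, t => (e.compile (t + 1)).bind fun _ => (f.compile (t + 2)).bind fun _ =>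
      (clear t).bind fun _ => (eqTest (t + 1) (t + 2)).bind fun b =>
        if b then inc t else Fragment.exit ()
  | get e, t => (e.compile (t + 1)).bind fun _ => fetch t (t + 1) (t + 2)

theorem le_update_zero {B : ℕ} {r : ℕ → ℕ} (hr : ∀ l, r l ≤ B) (t l : ℕ) :
    Function.update r t 0 l ≤ B := by
  rw [Function.update_apply]
  split_ifs
  · exact Nat.zero_le _
  · exact hr l

/-- Registers are used as a stack: variables lie below `u`, pending intermediate results below `t`,
and everything from `t` on is scratch space. Thus `u` stays fixed while `t` grows in the induction.
The bound `B` is maintained for all registers, scratch included, since clearing a register takes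
space according to its old contents. -/
theorem runs_compile {k : ℕ} [NeZero k] {N : List ℕ} {w : List Bool} (hw : w = encodeNats N)
    {b d B s : ℕ} (hb : 2 ≤ b) (hN : ∀ x ∈ N, x ≤ b) (hbB : b ≤ B) (hB : B.size + 2 < s)
    {v : ℕ → ℕ} (hv : ∀ i, v i ≤ b ^ d) (e : NatExpr) {o : List Bool} {u : ℕ} (hu : e.Scoped u)
    (t : ℕ) (ht : u ≤ t)
    (hk : t + e.width ≤ k) (hdeg : b ^ e.deg d ≤ B) (r : ℕ → ℕ) (hr : ∀ l, r l ≤ B)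
    (hvr : ∀ i < u, v i = r i) :
    ∃ r', (e.compile (k := k) t).Runs w s (registerTapes k r 0 o) () (registerTapes k r' 0 o) ∧
      (∀ l, r' l ≤ B) ∧ r' t = e.eval N v ∧ ∀ l < t, r' l = r l := by
  have hval := (e.eval_le hb hN hv).trans hdeg
  have hpos (n : ℕ) : 1 ≤ b ^ n := Nat.one_le_pow _ _ (by lia)
  have hmono {m n : ℕ} (hn : b ^ n ≤ B) (hmn : m ≤ n) : b ^ m ≤ B :=
    (Nat.pow_le_pow_right (by lia) hmn).trans hn
  induction e generalizing t r with
  | var i =>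
    simp only [width, Scoped] at hk hu
    obtain ⟨r', h1, h2, h3, h4⟩ := runs_addTo (w := w) (o := o) (k := k) (i := t) (j := i)
      (t := t + 1) (by lia) (by lia) (by lia) (by lia) (by lia) (by lia) hB
      (le_update_zero hr t) (by simp [(hu.trans_le ht).ne, hr])
    refine ⟨r', (runs_clear (by lia) (hr t) hB (by lia)).bind h1, h2, ?_, fun l hl => ?_⟩
    · rw [h3]
      simp [(hu.trans_le ht).ne, eval, hvr i hu]
    · rw [h4 l (by lia) (by lia), Function.update_of_ne (by lia)]
  | zero =>
    simp only [width] at hk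
    exact ⟨_, runs_clear (by lia) (hr t) hB (by lia), le_update_zero hr t, by simp [eval],
      fun l hl => Function.update_of_ne (by lia) _ _⟩
  | succ e ih =>
    simp only [width] at hk
    obtain ⟨r₁, h1, h2, h3, h4⟩ := ih hu t ht (by lia)
      (hmono hdeg (by simp only [deg]; lia)) r hr hvr
      (by simp only [eval] at hval; lia)
    refine ⟨_, h1.bind (runs_inc (by lia) (h2 t) hB (by lia)), fun l => ?_, ?_, fun l hl => ?_⟩
    · rw [Function.update_apply, h3]
      split_ifs
      · exact hval
      · exact h2 l
    · rw [Function.update_self, h3]; rfl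
    · rw [Function.update_of_ne (by lia), h4 l hl]
  | add e f ihe ihf =>
    simp only [width] at hk
    simp only [eval] at hval
    obtain ⟨r₁, e1, e2, e3, e4⟩ := ihe hu.1 t ht (by lia)
      (hmono hdeg (by simp only [deg]; lia)) r hr hvr (by lia)
    obtain ⟨r₂, f1, f2, f3, f4⟩ := ihf hu.2 (t + 1) (by lia) (by lia)
      (hmono hdeg (by simp only [deg]; lia)) r₁ e2
      (fun i hi => by rw [hvr i hi, e4 i (by lia)]) (by lia)
    have h5 : r₂ t = e.eval N v := by rw [f4 t (by lia), e3]
    obtain ⟨r₃, g1, g2, g3, g4⟩ := runs_addTo (w := w) (o := o) (k := k) (i := t) (j := t + 1)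
      (t := t + 2) (by lia) (by lia) (by lia) (by lia) (by lia) (by lia) hB f2 (by lia)
    refine ⟨r₃, e1.bind (f1.bind g1), g2, by rw [g3, h5, f3]; rfl, fun l hl => ?_⟩
    rw [g4 l (by lia) (by lia), f4 l (by lia), e4 l hl]
  | mul e f ihe ihf =>
    simp only [width] at hk
    simp only [eval] at hval ⊢
    have hdegs := hdeg
    simp only [deg] at hdegs
    have he := (e.eval_le hb hN hv).trans (hmono hdegs (Nat.le_add_right _ _))
    have hf := (f.eval_le hb hN hv).trans (hmono hdegs (Nat.le_add_left _ _))
    obtain ⟨r₁, e1, e2, e3, e4⟩ := ihe hu.1 (t + 1) (by lia) (by lia)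
      (hmono hdegs (Nat.le_add_right _ _)) r hr hvr he
    obtain ⟨r₂, f1, f2, f3, f4⟩ := ihf hu.2 (t + 2) (by lia) (by lia)
      (hmono hdegs (Nat.le_add_left _ _)) r₁ e2
      (fun i hi => by rw [hvr i hi, e4 i (by lia)]) hf
    have h5 : r₂ (t + 1) = e.eval N v := by rw [f4 (t + 1) (by lia), e3]
    -- Multiplication by repeated addition: `t` accumulates, `t + 1` and `t + 2` hold the factors,
    -- `t + 3` counts the additions and `t + 4` is the scratch register of `addTo`. After `x` passes
    -- the sum is `x` times the second factor.
    obtain ⟨r₃, o', g1, g2, g3, g4, g5, g6, g7, rfl⟩ := runs_forLoop (k := k) (w := w)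
      (F := addTo t (t + 2) (t + 4)) (i := t + 3) (j := t + 1) (by lia) (by lia) hB he
      (fun x r' o' => r' (t + 3) = x ∧ r' (t + 1) = e.eval N v ∧ r' (t + 2) = f.eval N v ∧
        r' t = x * f.eval N v ∧ (∀ l, r' l ≤ B) ∧ (∀ l < t, r' l = r l) ∧ o' = o)
      (fun x r' o' h => ⟨h.1, h.2.1⟩)
      (fun x hx r' o' ⟨h1, h2, h3, h4, h5, h6, h7⟩ => by
        -- Partial sums do not exceed the final product, which is bounded by `hval`.
        have hx' : x * f.eval N v + f.eval N v ≤ B := by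
          refine le_trans ?_ hval
          rw [← Nat.succ_mul]
          exact Nat.mul_le_mul_right _ hx
        obtain ⟨r'', k1, k2, k3, k4⟩ := runs_addTo (w := w) (o := o') (k := k) (i := t)
          (j := t + 2) (t := t + 4) (by lia) (by lia) (by lia) (by lia) (by lia) (by lia) hB h5
          (by lia)
        refine ⟨r'', o', k1, by rw [k4 _ (by lia) (by lia), h1], by simp, ?_, ?_, ?_, ?_, ?_, h7⟩
        · rw [Function.update_of_ne (by lia), k4 _ (by lia) (by lia), h2]
        · rw [Function.update_of_ne (by lia), k4 _ (by lia) (by lia), h3]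
        · rw [Function.update_of_ne (by lia), k3, h3, h4, Nat.succ_mul]
        · intro l
          rw [Function.update_apply]
          split_ifs
          · lia
          · exact k2 l
        · intro l hl
          rw [Function.update_of_ne (by lia), k4 _ (by lia) (by lia), h6 l hl])
      (r := Function.update r₂ t 0) (o := o) (le_update_zero f2 t _) (by
        refine ⟨by simp, by simp [h5], by simp [f3], by simp, ?_, ?_, rfl⟩
        · exact le_update_zero (le_update_zero f2 t) _
        · intro l hl
          rw [Function.update_of_ne (by lia), Function.update_of_ne (by lia), f4 l (by lia),
            e4 l (by lia)])
    exact ⟨r₃, e1.bind (f1.bind ((runs_clear (by lia) (f2 t) hB (by lia)).bind g1)), g6, g5, g7⟩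
  | eq e f ihe ihf =>
    simp only [width] at hk
    simp only [eval] at hval ⊢
    have hdegs := hdeg
    simp only [deg] at hdegs
    have he := (e.eval_le hb hN hv).trans (hmono hdegs (Nat.le_add_right _ _))
    have hf := (f.eval_le hb hN hv).trans (hmono hdegs (Nat.le_add_left _ _))
    obtain ⟨r₁, e1, e2, e3, e4⟩ := ihe hu.1 (t + 1) (by lia) (by lia)
      (hmono hdegs (Nat.le_add_right _ _)) r hr hvr he
    obtain ⟨r₂, f1, f2, f3, f4⟩ := ihf hu.2 (t + 2) (by lia) (by lia)
      (hmono hdegs (Nat.le_add_left _ _)) r₁ e2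
      (fun i hi => by rw [hvr i hi, e4 i (by lia)]) hf
    have h5 : r₂ (t + 1) = e.eval N v := by rw [f4 (t + 1) (by lia), e3]
    have htest := runs_eqTest (k := k) (w := w) (i := t + 1) (j := t + 2) (o := o) (by lia)
      (by lia) (le_update_zero f2 t _) hB (p := 0) (by lia)
    rw [Function.update_of_ne (by lia), Function.update_of_ne (by lia), h5, f3] at htest
    by_cases h : e.eval N v = f.eval N v
    · simp only [h, decide_true] at htest
      refine ⟨Function.update r₂ t 1, e1.bind (f1.bind ((runs_clear (by lia) (f2 t) hB
        (by lia)).bind (htest.bind ?_))), fun l => ?_, by simp [h], fun l hl => ?_⟩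
      · have hinc := runs_inc (k := k) (w := w) (i := t) (o := o) (by lia)
          (le_update_zero f2 t _) hB (p := 0) (by lia)
        rw [Function.update_self, Function.update_idem] at hinc
        exact hinc
      · rw [Function.update_apply]
        split_ifs
        · lia
        · exact f2 l
      · rw [Function.update_of_ne (by lia), f4 l (by lia), e4 l (by lia)]
    · simp only [h, decide_false] at htest
      refine ⟨Function.update r₂ t 0, e1.bind (f1.bind ((runs_clear (by lia) (f2 t) hB
        (by lia)).bind (htest.bind (runs_exit _ (by lia) (by lia))))), le_update_zero f2 t,
        by simp [h], fun l hl => ?_⟩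
      rw [Function.update_of_ne (by lia), f4 l (by lia), e4 l (by lia)]
  | get e ih =>
    simp only [width] at hk
    have hdegs := hmono hdeg (m := e.deg d) (by simp only [deg]; lia)
    obtain ⟨r₁, e1, e2, e3, e4⟩ := ih hu (t + 1) (by lia) (by lia) hdegs r hr hvr
      ((e.eval_le hb hN hv).trans hdegs)
    obtain ⟨r₂, f1, f2, f3, f4⟩ := runs_fetch (k := k) (z := t) (q := t + 1) (c := t + 2)
      (o := o) (by lia) (by lia) (by lia) (by lia) (by lia) (by lia) hB
      (fun x hx => (hN x hx).trans hbB) hw e2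
    refine ⟨r₂, e1.bind f1, f2, by rw [f3, e3]; rfl, fun l hl => ?_⟩
    rw [f4 l (by lia) (by lia), e4 l (by lia)]

end NatExpr

/-- Programs that write lists of numbers. -/
inductive NatProg : Type where
  | emit (e : NatExpr)
  | seq (S T : NatProg)
  | forTo (e : NatExpr) (S : NatProg)

namespace NatProg

/-- The list written on the input `N` by a program that stands inside loops which have occupied
the variables with numbers below `t`. A further loop keeps the number of its executions in the
variable `t` and counts them in the variable `t + 1`. -/
def eval (N : List ℕ) : ℕ → (ℕ → ℕ) → NatProg → List ℕ
  | _, v, emit e => [e.eval N v]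
  | t, v, seq S T => S.eval N t v ++ T.eval N t v
  | t, v, forTo e S => (List.range (e.eval N v)).flatMap fun x =>
      S.eval N (t + 2) (Function.update (Function.update v t (e.eval N v)) (t + 1) x)

/-- No variable is used before it is introduced. -/
def Scoped : ℕ → NatProg → Prop
  | t, emit e => e.Scoped t
  | t, seq S T => S.Scoped t ∧ T.Scoped t
  | t, forTo e S => e.Scoped t ∧ S.Scoped (t + 2)

/-- The number of registers that suffice. -/
def width : NatProg → ℕ
  | emit e => e.width + 2
  | seq S T => S.width + T.width
  | forTo e S => e.width + S.width + 2

/-- All numbers that occur are at most `b ^ deg d S`, if the input numbers are at most `b` and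
the values of the variables are at most `b ^ d`. -/
def deg : ℕ → NatProg → ℕ
  | d, emit e => e.deg d
  | d, seq S T => S.deg d + T.deg d
  | d, forTo e S => e.deg d + S.deg (d + e.deg d)

open Fragment

/-- Executing a program with variables in the registers below `t`. -/
def compile {k : ℕ} [NeZero k] : ℕ → NatProg → Fragment k Unit
  | t, emit e => (e.compile t).bind fun _ => (forLoop (t + 1) t (write true)).bind fun _ =>
      write false
  | t, seq S T => (S.compile t).bind fun _ => T.compile t
  | t, forTo e S => (e.compile t).bind fun _ => forLoop (t + 1) t (S.compile (t + 2))

theorem _root_.encodeNats_append (l l' : List ℕ) :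
    encodeNats (l ++ l') = encodeNats l ++ encodeNats l' :=
  List.flatMap_append

/-- Register `t` keeps the bound of a loop and `t + 1` its counter, so the body runs with two more
variables. Their values are at most `b ^ e.deg d`, hence `d` becomes `d + e.deg d` for the body. -/
theorem runs_compile {k : ℕ} [NeZero k] {N : List ℕ} {w : List Bool} (hw : w = encodeNats N)
    {b B s : ℕ} (hb : 2 ≤ b) (hN : ∀ x ∈ N, x ≤ b) (hbB : b ≤ B) (hB : B.size + 2 < s)
    (S : NatProg) {d : ℕ} {v : ℕ → ℕ} (hv : ∀ i, v i ≤ b ^ d) {o : List Bool} {t : ℕ}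
    (hS : S.Scoped t) (hk : t + S.width ≤ k) (hdeg : b ^ S.deg d ≤ B) {r : ℕ → ℕ}
    (hr : ∀ l, r l ≤ B) (hvr : ∀ i < t, v i = r i) :
    ∃ r', (S.compile (k := k) t).Runs w s (registerTapes k r 0 o) ()
        (registerTapes k r' 0 (o ++ encodeNats (S.eval N t v))) ∧
      (∀ l, r' l ≤ B) ∧ ∀ l < t, r' l = r l := by
  have hmono {m n : ℕ} (hn : b ^ n ≤ B) (hmn : m ≤ n) : b ^ m ≤ B :=
    (Nat.pow_le_pow_right (by lia) hmn).trans hn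
  induction S generalizing d v o t r with
  | emit e =>
    simp only [width] at hk
    obtain ⟨r₁, h1, h2, h3, h4⟩ := e.runs_compile (k := k) (o := o) hw hb hN hbB hB hv hS t le_rfl
      (by lia) hdeg r hr hvr
    -- Unary output: after `x` passes exactly `x` ones have been written; the terminating zero
    -- follows the loop.
    obtain ⟨r₂, o', g1, g2, g3, g4, rfl⟩ := runs_forLoop (k := k) (w := w)
      (F := write true) (i := t + 1) (j := t) (by lia) (by lia) hB (h3 ▸ h2 t)
      (fun x r' o' => r' (t + 1) = x ∧ x ≤ e.eval N v ∧ (∀ l ≠ t + 1, r' l = r₁ l) ∧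
        o' = o ++ List.replicate x true)
      (fun x r' o' h => ⟨h.1, by rw [h.2.2.1 t (by lia), h3]⟩)
      (fun x hx r' o' ⟨h5, h6, h7, h8⟩ => ⟨r', _, runs_write true (by lia) (by lia), h5, by simp,
        hx, fun l hl => by rw [Function.update_of_ne hl, h7 l hl],
        by rw [h8, List.append_assoc, List.replicate_succ']⟩)
      (r := r₁) (o := o) (h2 _) ⟨by simp, by lia,
        fun l hl => by rw [Function.update_of_ne hl], by simp⟩
    refine ⟨r₂, h1.bind (g1.bind ?_), fun l => ?_, fun l hl => ?_⟩
    · have h := runs_write (k := k) (w := w) (s := s) false (by lia) (r := r₂) (p := 0) (by lia)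
        (o := o ++ List.replicate (e.eval N v) true)
      simpa [eval, encodeNats] using h
    · by_cases hl : l = t + 1
      · rw [hl, g2, ← h3]; exact h2 t
      · rw [g4 l hl]; exact h2 l
    · rw [g4 l (by lia), h4 l hl]
  | seq S T ihS ihT =>
    simp only [width] at hk
    simp only [deg] at hdeg
    obtain ⟨r₁, h1, h2, h3⟩ := ihS (o := o) hv hS.1 (by lia) (hmono hdeg (Nat.le_add_right _ _))
      hr hvr
    obtain ⟨r₂, g1, g2, g3⟩ := ihT (o := o ++ encodeNats (S.eval N t v)) hv hS.2 (by lia)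
      (hmono hdeg (Nat.le_add_left _ _)) h2 (fun i hi => by rw [hvr i hi, h3 i hi])
    refine ⟨r₂, h1.bind ?_, g2, fun l hl => by rw [g3 l hl, h3 l hl]⟩
    rw [eval, encodeNats_append, ← List.append_assoc]
    exact g1
  | forTo e S ih =>
    simp only [width] at hk
    simp only [deg] at hdeg
    have hdeg' := hmono hdeg (Nat.le_add_right _ _)
    obtain ⟨r₁, h1, h2, h3, h4⟩ := e.runs_compile (k := k) (o := o) hw hb hN hbB hB hv hS.1 t
      le_rfl (by lia) hdeg' r hr hvr
    have hn := e.eval_le hb hN hv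
    -- Invariant: the output of the passes `0, …, x - 1` has been appended, and the registers up to
    -- `t`, among them the loop bound, are intact.
    obtain ⟨r₂, o', g1, g2, g3, g4, g5, rfl⟩ := runs_forLoop (k := k) (w := w)
      (F := S.compile (t + 2)) (i := t + 1) (j := t) (by lia) (by lia) hB (hn.trans hdeg')
      (fun x r' o' => r' (t + 1) = x ∧ x ≤ e.eval N v ∧ (∀ l ≤ t, r' l = r₁ l) ∧
        (∀ l, r' l ≤ B) ∧
        o' = o ++ encodeNats ((List.range x).flatMap fun y => S.eval N (t + 2)
          (Function.update (Function.update v t (e.eval N v)) (t + 1) y)))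
      (fun x r' o' h => ⟨h.1, by rw [h.2.2.1 t le_rfl, h3]⟩)
      (fun x hx r' o' ⟨h5, h6, h7, h8, h9⟩ => by
        obtain ⟨r'', k1, k2, k3⟩ := ih (o := o') (d := d + e.deg d)
          (v := Function.update (Function.update v t (e.eval N v)) (t + 1) x) (t := t + 2)
          (r := r') (by
            have hle : b ^ e.deg d ≤ b ^ (d + e.deg d) := Nat.pow_le_pow_right (by lia) (by lia)
            intro i
            simp only [Function.update_apply]
            split_ifs
            · lia
            · lia
            · exact (hv i).trans (Nat.pow_le_pow_right (by lia) (by lia)))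
          hS.2 (by lia) (hmono hdeg (Nat.le_add_left _ _)) h8 (by
            intro i hi
            rcases (by lia : i = t + 1 ∨ i = t ∨ i < t) with rfl | rfl | hi
            · simp [h5]
            · rw [h7 _ le_rfl, h3]; simp
            · rw [Function.update_of_ne (by lia), Function.update_of_ne (by lia), hvr i hi,
                h7 i hi.le, h4 i hi])
        refine ⟨r'', _, k1, by rw [k3 _ (by lia), h5], by simp, hx, fun l hl => ?_, fun l => ?_, ?_⟩
        · rw [Function.update_of_ne (by lia), k3 l (by lia), h7 l hl]
        · rw [Function.update_apply]
          split_ifs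
          · exact (Nat.succ_le_of_lt hx).trans (hn.trans hdeg')
          · exact k2 l
        · rw [h9, List.range_succ, List.flatMap_append, encodeNats_append, List.append_assoc]
          simp)
      (r := r₁) (o := o) (h2 _) ⟨by simp, by lia,
        fun l hl => by rw [Function.update_of_ne (by lia)], NatExpr.le_update_zero h2 _,
        by simp [encodeNats]⟩
    exact ⟨r₂, h1.bind g1, g5, fun l hl => by rw [g4 l hl.le, h4 l hl]⟩

/-- A blank tape with an end marker in cell `0` represents the register value `0`, whose binary
expansion is empty. -/
theorem runs_mark {k : ℕ} {w : List Bool} {s : ℕ} (hs : 1 < s) :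
    (mark (k := k)).Runs w s (initTapes k) () (registerTapes k (fun _ => 0) 0 []) := by
  have h : registerTapes k (fun _ => 0) 0 [] = (initTapes k).act w
      (HeadMove.stay, fun _ => (InputSymbol.leftEnd, HeadMove.right), none) := by
    ext i p
    · simp [registerTapes, Tapes.act, initTapes, TuringTransducer.moveHead]
    · rcases p with _ | p <;> simp [registerTapes, Tapes.act, initTapes,
        TuringTransducer.readInput]
    · simp [registerTapes, Tapes.act, initTapes, TuringTransducer.moveHead]
    · simp [registerTapes, Tapes.act, initTapes]
  rw [h]
  exact .single (.mk _ _ _ _ rfl fun i => by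
    simpa [Tapes.act, initTapes, TuringTransducer.moveHead] using hs)

/-- This is where the unary encoding matters: input numbers are bounded by the input length. -/
theorem le_length_encodeNats {N : List ℕ} {x : ℕ} (hx : x ∈ N) : x ≤ (encodeNats N).length := by
  induction N with
  | nil => cases hx
  | cons y N ih =>
    have h : (encodeNats (y :: N)).length = y + 1 + (encodeNats N).length := by
      simp [encodeNats]; lia
    rcases List.mem_cons.1 hx with rfl | hx
    · lia
    · have := ih hx; lia

/-- Transformations of lists of numbers that are defined by programs can be computed in
logarithmic space. -/
theorem logspaceComputable (S : NatProg) (hS : S.Scoped 0) {ι : Type*} (N N' : ι → List ℕ)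
    (h : ∀ i, S.eval (N i) 0 (fun _ => 0) = N' i) :
    LogspaceComputable (fun i => encodeNats (N i)) fun i => encodeNats (N' i) := by
  -- The summand `1` makes the exponent positive, so that the base `w.length + 2` is itself at most
  -- `B = (w.length + 2) ^ D`. Likewise `S.width + 1` guarantees at least one tape.
  set D := S.deg 0 + 1 with hD
  refine ⟨(mark.bind fun _ => S.compile (k := S.width + 1) 0).toTransducer, 2 * D + 4,
    fun i => ?_⟩
  dsimp only
  set w := encodeNats (N i) with hw
  set ℓ := Nat.log 2 w.length with hℓ
  have hb : w.length + 2 ≤ 2 ^ (ℓ + 2) := by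
    have := Nat.lt_pow_succ_log_self (b := 2) (by lia) w.length
    have h1 := Nat.one_le_two_pow (n := ℓ)
    rw [← hℓ] at this
    rw [pow_succ] at this ⊢
    rw [pow_succ] at *
    lia
  -- The bound `B` has at most `(ℓ + 2) * D + 1` bits, since `w.length + 2 ≤ 2 ^ (ℓ + 2)`.
  have hB : ((w.length + 2) ^ D).size + 2 < (2 * D + 4) * (ℓ + 1) := by
    have h1 : (w.length + 2) ^ D < 2 ^ ((ℓ + 2) * D + 1) := by
      calc (w.length + 2) ^ D ≤ (2 ^ (ℓ + 2)) ^ D := Nat.pow_le_pow_left hb D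
        _ = 2 ^ ((ℓ + 2) * D) := (pow_mul _ _ _).symm
        _ < _ := Nat.pow_lt_pow_right (by lia) (by lia)
    have h2 := Nat.size_le.2 h1
    nlinarith
  obtain ⟨r', h1, -, -⟩ := runs_compile (k := S.width + 1) hw (b := w.length + 2)
    (B := (w.length + 2) ^ D) (by lia)
    (fun x hx => (le_length_encodeNats hx).trans (by lia)) (Nat.le_self_pow (by lia) _) hB S
    (d := 0) (v := fun _ => 0) (fun _ => Nat.zero_le _) (o := []) (t := 0) hS (by lia)
    (Nat.pow_le_pow_right (by lia) (by lia)) (r := fun _ => 0) (fun _ => Nat.zero_le _)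
    (fun _ _ => rfl)
  rw [h i, List.nil_append] at h1
  have hs : 1 < (2 * D + 4) * (ℓ + 1) := by omega
  exact Runs.computesInSpace (by omega)
    (Runs.bind (G := fun _ => S.compile (k := S.width + 1) 0) (runs_mark hs) h1)

end NatProg

/-! ### Tables -/

/-- The table of a function of two arguments, row by row. -/
def natTable {n m : ℕ} (f : Fin n → Fin m → ℕ) : List ℕ :=
  (List.finRange n).flatMap fun i => (List.finRange m).flatMap fun j => [f i j]

/-- All tables are brought into the form `natTable`, functions of one argument and sets as tables
with a single row, so that one lookup lemma and one product program serve for most of them. -/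
theorem table₂_eq_natTable {n m k : ℕ} (f : Fin n → Fin m → Fin k) :
    table₂ f = natTable fun i j => (f i j : ℕ) := by
  simp only [table₂, table₁, natTable, List.map_eq_flatMap]

theorem table₁_eq_natTable {m k : ℕ} (f : Fin m → Fin k) :
    table₁ f = natTable fun (_ : Fin 1) j => (f j : ℕ) := by
  simp [table₁, natTable, List.map_eq_flatMap, List.finRange_succ]

open Classical in
theorem tableSet_eq_natTable {m : ℕ} (E : Set (Fin m)) :
    tableSet E = natTable fun (_ : Fin 1) j => if j ∈ E then 1 else 0 := by
  simp [tableSet, natTable, List.map_eq_flatMap, List.finRange_succ]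

theorem flatMap_finRange {β : Type*} {n : ℕ} (f : Fin n → List β) (g : ℕ → List β)
    (h : ∀ i : Fin n, f i = g i) : (List.finRange n).flatMap f = (List.range n).flatMap g := by
  rw [← List.map_coe_finRange_eq_range, List.flatMap_map]
  exact List.flatMap_congr fun i _ => h i

/-- Division with remainder by `b`: the numbers below `a * b` in increasing order are the pairs in
lexicographic order. -/
theorem flatMap_range_mul {β : Type*} (a b : ℕ) (g : ℕ → List β) :
    (List.range (a * b)).flatMap g =
      (List.range a).flatMap fun i => (List.range b).flatMap fun j => g (i * b + j) := by
  induction a with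
  | zero => simp
  | succ a ih =>
    rw [Nat.succ_mul, List.range_add, List.flatMap_append, ih, List.range_succ,
      List.flatMap_append, List.flatMap_map]
    simp

theorem flatMap_finRange_mul {β : Type*} {a b : ℕ} (f : Fin (a * b) → List β)
    (g : ℕ → ℕ → List β) (h : ∀ (i : Fin a) (j : Fin b), f (finProdFinEquiv (i, j)) = g i j) :
    (List.finRange (a * b)).flatMap f =
      (List.range a).flatMap fun i => (List.range b).flatMap fun j => g i j := by
  -- The value `[]` outside the range is never used; it only extends `f` to a function on `ℕ`.
  rw [flatMap_finRange f (fun n => if hn : n < a * b then f ⟨n, hn⟩ else [])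
    (fun i => by simp), flatMap_range_mul]
  refine List.flatMap_congr fun i hi => List.flatMap_congr fun j hj => ?_
  rw [List.mem_range] at hi hj
  have hval : ((finProdFinEquiv (⟨i, hi⟩, ⟨j, hj⟩) : Fin (a * b)) : ℕ) = i * b + j := by
    simp [mul_comm, add_comm]
  have hlt : i * b + j < a * b := hval ▸ Fin.is_lt _
  rw [dif_pos hlt, ← h ⟨i, hi⟩ ⟨j, hj⟩]
  congr 1
  exact Fin.ext hval.symm

theorem length_natTable {n m : ℕ} (f : Fin n → Fin m → ℕ) : (natTable f).length = n * m := by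
  simp [natTable]

/-- The table of `f` occurs in `N`, from the position `p` on. -/
def HasTable (N : List ℕ) (p : ℕ) {n m : ℕ} (f : Fin n → Fin m → ℕ) : Prop :=
  ∀ (i : Fin n) (j : Fin m), N.getD (p + i * m + j) 0 = f i j

/-- Row-major addressing: all rows have length `m`, so row `i` begins at `i * m`. -/
theorem getD_flatMap_finRange {n m : ℕ} (g : Fin n → List ℕ) (hg : ∀ i, (g i).length = m)
    (i : Fin n) {j : ℕ} (hj : j < m) :
    ((List.finRange n).flatMap g).getD (i * m + j) 0 = (g i).getD j 0 := by
  induction n with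
  | zero => exact i.elim0
  | succ n ih =>
    rw [List.finRange_succ, List.flatMap_cons, List.flatMap_map]
    cases i using Fin.cases with
    | zero => rw [Fin.val_zero, zero_mul, zero_add, List.getD_append _ _ _ _ (by rw [hg]; exact hj)]
    | succ i =>
      rw [List.getD_append_right _ _ _ _ (by rw [hg, Fin.val_succ, Nat.succ_mul]; lia), hg,
        show (i.succ : ℕ) * m + j - m = i * m + j by rw [Fin.val_succ, Nat.succ_mul]; omega]
      exact ih (fun i => g i.succ) (fun i => hg _) i

theorem hasTable_append {n m : ℕ} (f : Fin n → Fin m → ℕ) {N P Q : List ℕ} {p : ℕ}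
    (hN : N = P ++ (natTable f ++ Q)) (hp : p = P.length) : HasTable N p f := by
  intro i j
  have hlt : (i : ℕ) * m + j < n * m := by
    calc (i : ℕ) * m + j < i * m + m := by lia
      _ = (i + 1) * m := (Nat.succ_mul _ _).symm
      _ ≤ n * m := Nat.mul_le_mul_right _ i.isLt
  rw [hN, hp, add_assoc, List.getD_append_right _ _ _ _ (by lia), Nat.add_sub_cancel_left,
    List.getD_append _ _ _ _ (by rwa [length_natTable]), natTable,
    getD_flatMap_finRange _ (by simp) i j.isLt]
  have h : (List.finRange m).flatMap (fun j => [f i j]) = (List.finRange m).map (f i) := by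
    rw [List.map_eq_flatMap]
  rw [h, List.getD_eq_getElem?_getD]
  simp

/-! ### Programs for products and complements -/

namespace NatExpr

instance : Zero NatExpr := ⟨zero⟩
instance : Add NatExpr := ⟨add⟩
instance : Mul NatExpr := ⟨mul⟩

/-- The expression for a number. -/
def num : ℕ → NatExpr
  | 0 => zero
  | n + 1 => succ (num n)

variable {N : List ℕ} {v : ℕ → ℕ}

@[simp] theorem eval_var (i : ℕ) : (var i).eval N v = v i := rfl
@[simp] theorem eval_zero : (0 : NatExpr).eval N v = 0 := rfl
@[simp] theorem eval_add (e f : NatExpr) : (e + f).eval N v = e.eval N v + f.eval N v := rfl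
@[simp] theorem eval_mul (e f : NatExpr) : (e * f).eval N v = e.eval N v * f.eval N v := rfl
@[simp] theorem eval_eq (e f : NatExpr) :
    (eq e f).eval N v = if e.eval N v = f.eval N v then 1 else 0 := rfl
@[simp] theorem eval_get (e : NatExpr) : (get e).eval N v = N.getD (e.eval N v) 0 := rfl
@[simp] theorem eval_num (n : ℕ) : (num n).eval N v = n := by
  induction n with
  | zero => rfl
  | succ n ih => simp only [num, eval, ih]

variable {t : ℕ}

@[simp] theorem scoped_var (i : ℕ) : (var i).Scoped t ↔ i < t := Iff.rfl
@[simp] theorem scoped_zero : (0 : NatExpr).Scoped t := trivial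
@[simp] theorem scoped_add (e f : NatExpr) : (e + f).Scoped t ↔ e.Scoped t ∧ f.Scoped t := Iff.rfl
@[simp] theorem scoped_mul (e f : NatExpr) : (e * f).Scoped t ↔ e.Scoped t ∧ f.Scoped t := Iff.rfl
@[simp] theorem scoped_eq (e f : NatExpr) :
    (eq e f).Scoped t ↔ e.Scoped t ∧ f.Scoped t := Iff.rfl
@[simp] theorem scoped_get (e : NatExpr) : (get e).Scoped t ↔ e.Scoped t := Iff.rfl
@[simp] theorem scoped_num (n : ℕ) : (num n).Scoped t := by
  induction n with
  | zero => trivial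
  | succ n ih => exact ih

end NatExpr

namespace NatProg

open NatExpr

/-- The product of two tables with `a` and `b` rows and `c` and `d` columns, which stand at the
positions `p` and `q`. -/
def prodTable (a b c d p q : NatExpr) (comb : NatExpr → NatExpr → NatExpr) : NatProg :=
  forTo a <| forTo b <| forTo c <| forTo d <|
    emit (comb (get (p + var 1 * c + var 5)) (get (q + var 3 * d + var 7)))

/-- The product of two tables with `a` and `b` rows and the same `c` columns, which stand at the
positions `p` and `q`. -/
def rowProdTable (a b c p q : NatExpr) (comb : NatExpr → NatExpr → NatExpr) : NatProg :=
  forTo a <| forTo b <| forTo c <|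
    emit (comb (get (p + var 1 * c + var 5)) (get (q + var 3 * c + var 5)))

/-- Copying the first `p` numbers, and replacing the next `a` numbers by their negations. -/
def complProg (p a : NatExpr) : NatProg :=
  seq (forTo p (emit (get (var 1)))) (forTo a (emit (eq (get (p + var 1)) 0)))

variable {N : List ℕ} {v : ℕ → ℕ}

/-- A loop takes two variables, the bound and then the counter, so the counters of the four loops
are the variables `1, 3, 5, 7`: row of the first table, row of the second, column of the first,
column of the second. This nesting is the order in which `finProdFinEquiv` numbers the rows and
columns of the product. -/
theorem eval_prodTable {a b c d : ℕ} {p q : ℕ} {ea eb ec ed ep eq : NatExpr}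
    (ha : ∀ v, ea.eval N v = a) (hb : ∀ v, eb.eval N v = b) (hc : ∀ v, ec.eval N v = c)
    (hd : ∀ v, ed.eval N v = d) {f : Fin a → Fin c → ℕ} {g : Fin b → Fin d → ℕ}
    (hep : ∀ v, ep.eval N v = p) (hp : HasTable N p f)
    (heq : ∀ v, eq.eval N v = q) (hq : HasTable N q g)
    {comb : NatExpr → NatExpr → NatExpr} {op : ℕ → ℕ → ℕ}
    (hcomb : ∀ x y v, (comb x y).eval N v = op (x.eval N v) (y.eval N v))
    {F : Fin (a * b) → Fin (c * d) → ℕ}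
    (hF : ∀ i i' j j', F (finProdFinEquiv (i, i')) (finProdFinEquiv (j, j')) =
      op (f i j) (g i' j')) :
    (prodTable ea eb ec ed ep eq comb).eval N 0 v = natTable F := by
  simp only [prodTable, NatProg.eval, hcomb, ha, hb, hc, hd, hep, heq, eval_get, eval_add, eval_mul,
    NatExpr.eval_var, natTable]
  refine (flatMap_finRange_mul _ _ fun i i' => flatMap_finRange_mul _ _ fun j j' => ?_).symm
  rw [hF, ← hp, ← hq]
  simp

/-- Used for tables whose columns are letters: both factors read the same letter, so only the rows
are paired. -/
theorem eval_rowProdTable {a b c : ℕ} {p q : ℕ} {ea eb ec ep eq : NatExpr}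
    (ha : ∀ v, ea.eval N v = a) (hb : ∀ v, eb.eval N v = b) (hc : ∀ v, ec.eval N v = c)
    {f : Fin a → Fin c → ℕ} {g : Fin b → Fin c → ℕ}
    (hep : ∀ v, ep.eval N v = p) (hp : HasTable N p f)
    (heq : ∀ v, eq.eval N v = q) (hq : HasTable N q g)
    {comb : NatExpr → NatExpr → NatExpr} {op : ℕ → ℕ → ℕ}
    (hcomb : ∀ x y v, (comb x y).eval N v = op (x.eval N v) (y.eval N v))
    {F : Fin (a * b) → Fin c → ℕ}
    (hF : ∀ i i' j, F (finProdFinEquiv (i, i')) j = op (f i j) (g i' j)) :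
    (rowProdTable ea eb ec ep eq comb).eval N 0 v = natTable F := by
  simp only [rowProdTable, NatProg.eval, hcomb, ha, hb, hc, hep, heq, eval_get, eval_add, eval_mul,
    NatExpr.eval_var, natTable]
  refine (flatMap_finRange_mul _ _ fun i i' => flatMap_finRange _ _ fun j => ?_).symm
  rw [hF, ← hp, ← hq]
  simp

/-- The accepting set stands at the end of an encoding, and comparison with `0` negates its entries
`0` and `1`. -/
theorem eval_complProg {n : ℕ} {ep en : NatExpr} {P : List ℕ} {E : Set (Fin n)}
    (hN : N = P ++ tableSet E) (hp : ∀ v, ep.eval N v = P.length) (hn : ∀ v, en.eval N v = n) :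
    (complProg ep en).eval N 0 v = P ++ tableSet Eᶜ := by
  simp only [complProg, NatProg.eval, hp, hn, eval_get, eval_add, NatExpr.eval_var, eval_eq, eval_zero,
    Function.update_self]
  congr 1
  · rw [← List.map_eq_flatMap]
    refine List.ext_getElem (by simp) fun i h1 h2 => ?_
    simp [hN, List.getElem?_append_left h2, h2]
  · rw [tableSet, List.map_eq_flatMap]
    have h := hasTable_append (P := P) (Q := []) (N := N) _
      (by rw [hN, List.append_nil, tableSet_eq_natTable]) rfl
    refine (flatMap_finRange _ _ fun i => ?_).symm
    have := h 0 i
    simp only [Fin.val_zero, zero_mul, add_zero] at this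
    rw [this]
    by_cases hi : i ∈ E <;> simp [hi]

end NatProg

namespace NatExpr

/-- The expression `e` contains no variables. -/
def Closed (e : NatExpr) : Prop := ∀ t, e.Scoped t

theorem Closed.add {e f : NatExpr} (he : e.Closed) (hf : f.Closed) : (e + f).Closed :=
  fun t => ⟨he t, hf t⟩

theorem Closed.mul {e f : NatExpr} (he : e.Closed) (hf : f.Closed) : (e * f).Closed :=
  fun t => ⟨he t, hf t⟩

theorem closed_zero : (0 : NatExpr).Closed := fun _ => trivial

theorem closed_num (n : ℕ) : (num n).Closed := fun _ => scoped_num n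

/-- The number of the pair of the elements numbered `x` and `y`, where `e` is the size of the
second factor. -/
def pair (e x y : NatExpr) : NatExpr := x * e + y

/-- The conjunction of two truth values. -/
def conj (x y : NatExpr) : NatExpr := x * y

/-- The disjunction of two truth values. -/
def disj (x y : NatExpr) : NatExpr := eq (eq (x + y) 0) 0

theorem eval_pair {N : List ℕ} {e : NatExpr} {n : ℕ} (he : ∀ v, e.eval N v = n) (x y : NatExpr)
    (v : ℕ → ℕ) : (pair e x y).eval N v = x.eval N v * n + y.eval N v := by
  simp [pair, he]

/-- The expression transformer `comb` introduces no variables. -/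
def Closed₂ (comb : NatExpr → NatExpr → NatExpr) : Prop :=
  ∀ t x y, x.Scoped t → y.Scoped t → (comb x y).Scoped t

theorem closed₂_pair {e : NatExpr} (he : e.Closed) : Closed₂ (pair e) :=
  fun t _ _ hx hy => ⟨⟨hx, he t⟩, hy⟩

theorem closed₂_conj : Closed₂ conj := fun _ _ _ hx hy => ⟨hx, hy⟩

theorem closed₂_disj : Closed₂ disj := fun _ _ _ hx hy => ⟨⟨⟨hx, hy⟩, trivial⟩, trivial⟩

end NatExpr

open NatExpr (num Closed closed_num closed_zero Closed₂ closed₂_pair)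

namespace NatProg

theorem scoped_prodTable {a b c d p q : NatExpr} {comb : NatExpr → NatExpr → NatExpr}
    (ha : a.Closed) (hb : b.Closed) (hc : c.Closed) (hd : d.Closed) (hp : p.Closed)
    (hq : q.Closed) (hcomb : Closed₂ comb) : (prodTable a b c d p q comb).Scoped 0 := by
  refine ⟨ha _, hb _, hc _, hd _, hcomb _ _ _ ?_ ?_⟩ <;> simp [hp _, hq _, hc _, hd _]

theorem scoped_rowProdTable {a b c p q : NatExpr} {comb : NatExpr → NatExpr → NatExpr}
    (ha : a.Closed) (hb : b.Closed) (hc : c.Closed) (hp : p.Closed)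
    (hq : q.Closed) (hcomb : Closed₂ comb) : (rowProdTable a b c p q comb).Scoped 0 := by
  refine ⟨ha _, hb _, hc _, hcomb _ _ _ ?_ ?_⟩ <;> simp [hp _, hq _, hc _]

theorem scoped_complProg {p a : NatExpr} (hp : p.Closed) (ha : a.Closed) :
    (complProg p a).Scoped 0 := by
  refine ⟨⟨hp _, ?_⟩, ha _, ?_⟩ <;> simp [Scoped, hp _]

end NatProg

theorem val_finProdFinEquiv {a b : ℕ} (i : Fin a) (j : Fin b) :
    ((finProdFinEquiv (i, j) : Fin (a * b)) : ℕ) = i * b + j := by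
  simp [mul_comm, add_comm]

/-! ### Automata in logarithmic space -/

namespace ForestAutomaton

/-- The encoding of an automaton as a list of numbers, without the accepting set. -/
def header {m : ℕ} (M : ForestAutomaton (Fin m)) : List ℕ :=
  [m, M.n, (M.num 0 : ℕ)]
    ++ table₂ (fun i j => M.num (M.num.symm i + M.num.symm j))
    ++ table₂ (fun i (a : Fin m) => M.num (M.δ (M.num.symm i) a))

/-- The encoding of an automaton as a list of numbers. -/
noncomputable def nats {m : ℕ} (M : ForestAutomaton (Fin m)) : List ℕ :=
  M.header ++ tableSet {i | M.num.symm i ∈ M.accept}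

theorem encode_eq {m : ℕ} (M : ForestAutomaton (Fin m)) : M.encode = encodeNats M.nats := rfl

theorem length_header {m : ℕ} (M : ForestAutomaton (Fin m)) :
    M.header.length = 3 + M.n * M.n + M.n * m := by
  simp [header, table₂_eq_natTable, length_natTable]; lia

theorem length_nats {m : ℕ} (M : ForestAutomaton (Fin m)) :
    M.nats.length = 3 + M.n * M.n + M.n * m + M.n := by
  simp [nats, length_header, tableSet]

open Classical in
/-- The automaton `M` is written down in `N` from the position `p` on. -/
structure WrittenAt {m : ℕ} (M : ForestAutomaton (Fin m)) (N : List ℕ) (p : ℕ) : Prop where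
  get_m : N.getD p 0 = m
  get_n : N.getD (p + 1) 0 = M.n
  get_zero : N.getD (p + 2) 0 = M.num 0
  add : HasTable N (p + 3) fun i j => (M.num (M.num.symm i + M.num.symm j) : ℕ)
  delta : HasTable N (p + 3 + M.n * M.n) fun i a => (M.num (M.δ (M.num.symm i) a) : ℕ)
  accept : HasTable N (p + 3 + M.n * M.n + M.n * m)
    fun (_ : Fin 1) i => if M.num.symm i ∈ M.accept then 1 else 0

/-- The surrounding lists `P` and `Q` are admitted because a binary operation receives two encodings
one after the other. -/
theorem writtenAt {m : ℕ} (M : ForestAutomaton (Fin m)) {N P Q : List ℕ}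
    (hN : N = P ++ (M.nats ++ Q)) {p : ℕ} (hp : p = P.length) : M.WrittenAt N p := by
  subst hp
  simp only [nats, header, tableSet_eq_natTable, table₂_eq_natTable, List.append_assoc] at hN
  constructor
  · simp [hN]
  · simp [hN]
  · simp [hN]
  · exact hasTable_append _ (P := P ++ [m, M.n, (M.num 0 : ℕ)])
      (hN.trans (by simp only [List.append_assoc]; rfl)) (by simp)
  · refine hasTable_append _ (P := P ++ ([m, M.n, (M.num 0 : ℕ)] ++ natTable _))
      (hN.trans (by simp only [List.append_assoc]; rfl)) ?_
    simp [length_natTable]; lia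
  · refine hasTable_append _ (P := P ++ ([m, M.n, (M.num 0 : ℕ)] ++ (natTable _ ++ natTable _)))
      (hN.trans (by simp only [List.append_assoc]; rfl)) ?_
    simp [length_natTable]; lia

theorem prod_num_symm {A : Type} (M M' : ForestAutomaton A) (E : Set (M.Q × M'.Q)) (i : Fin M.n)
    (i' : Fin M'.n) : (M.prod M' E).num.symm (finProdFinEquiv (i, i')) =
      (M.num.symm i, M'.num.symm i') :=
  congrArg (M.num.symm.prodCongr M'.num.symm) (finProdFinEquiv.symm_apply_apply (i, i'))

end ForestAutomaton

namespace AutomatonLayout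

open NatExpr NatProg

/-! Expressions for the parts of the encoding of an automaton that starts at the position `p`. -/

def exprM (p : NatExpr) : NatExpr := get p
def exprN (p : NatExpr) : NatExpr := get (p + num 1)
def exprZero (p : NatExpr) : NatExpr := get (p + num 2)
def posAdd (p : NatExpr) : NatExpr := p + num 3
def posDelta (p : NatExpr) : NatExpr := posAdd p + exprN p * exprN p
def posAccept (p : NatExpr) : NatExpr := posDelta p + exprN p * exprM p
def posEnd (p : NatExpr) : NatExpr := posAccept p + exprN p

variable {p : NatExpr}

theorem closed_exprM (hp : p.Closed) : (exprM p).Closed := hp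
theorem closed_exprN (hp : p.Closed) : (exprN p).Closed := hp.add (closed_num _)
theorem closed_exprZero (hp : p.Closed) : (exprZero p).Closed := hp.add (closed_num _)
theorem closed_posAdd (hp : p.Closed) : (posAdd p).Closed := hp.add (closed_num _)
theorem closed_posDelta (hp : p.Closed) : (posDelta p).Closed :=
  (closed_posAdd hp).add ((closed_exprN hp).mul (closed_exprN hp))
theorem closed_posAccept (hp : p.Closed) : (posAccept p).Closed :=
  (closed_posDelta hp).add ((closed_exprN hp).mul (closed_exprM hp))
theorem closed_posEnd (hp : p.Closed) : (posEnd p).Closed :=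
  (closed_posAccept hp).add (closed_exprN hp)

variable {m : ℕ} {M : ForestAutomaton (Fin m)} {N : List ℕ} {n : ℕ}

theorem eval_exprM (hp : ∀ v, p.eval N v = n) (h : M.WrittenAt N n) (v : ℕ → ℕ) :
    (exprM p).eval N v = m := by
  rw [exprM, eval_get, hp, h.get_m]
theorem eval_exprN (hp : ∀ v, p.eval N v = n) (h : M.WrittenAt N n) (v : ℕ → ℕ) :
    (exprN p).eval N v = M.n := by
  rw [exprN, eval_get, NatExpr.eval_add, eval_num, hp, h.get_n]
theorem eval_exprZero (hp : ∀ v, p.eval N v = n) (h : M.WrittenAt N n) (v : ℕ → ℕ) :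
    (exprZero p).eval N v = M.num 0 := by
  rw [exprZero, eval_get, NatExpr.eval_add, eval_num, hp, h.get_zero]
theorem eval_posAdd (hp : ∀ v, p.eval N v = n) (v : ℕ → ℕ) :
    (posAdd p).eval N v = n + 3 := by
  rw [posAdd, NatExpr.eval_add, eval_num, hp]
theorem eval_posDelta (hp : ∀ v, p.eval N v = n) (h : M.WrittenAt N n) (v : ℕ → ℕ) :
    (posDelta p).eval N v = n + 3 + M.n * M.n := by
  simp only [posDelta, NatExpr.eval_add, eval_mul, eval_posAdd hp, eval_exprN hp h]
theorem eval_posAccept (hp : ∀ v, p.eval N v = n) (h : M.WrittenAt N n) (v : ℕ → ℕ) :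
    (posAccept p).eval N v = n + 3 + M.n * M.n + M.n * m := by
  simp only [posAccept, NatExpr.eval_add, eval_mul, eval_posDelta hp h, eval_exprN hp h,
    eval_exprM hp h]
-- An encoding determines its own length through its sizes, so the second automaton can be located
-- without a separator.
theorem eval_posEnd (hp : ∀ v, p.eval N v = n) (h : M.WrittenAt N n) (v : ℕ → ℕ) :
    (posEnd p).eval N v = n + M.nats.length := by
  simp only [posEnd, NatExpr.eval_add, eval_posAccept hp h, eval_exprN hp h,
    ForestAutomaton.length_nats]
  lia

/-- The product of two automata written down from the positions `p` and `q` on. -/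
def product (p q : NatExpr) (comb : NatExpr → NatExpr → NatExpr) : NatProg :=
  seq (emit (exprM p)) <| seq (emit (exprN p * exprN q)) <|
  seq (emit (pair (exprN q) (exprZero p) (exprZero q))) <|
  seq (prodTable (exprN p) (exprN q) (exprN p) (exprN q) (posAdd p) (posAdd q)
    (pair (exprN q))) <|
  seq (rowProdTable (exprN p) (exprN q) (exprM p) (posDelta p) (posDelta q) (pair (exprN q))) <|
  prodTable (num 1) (num 1) (exprN p) (exprN q) (posAccept p) (posAccept q) comb

theorem scoped_product {q : NatExpr} (hp : p.Closed) (hq : q.Closed)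
    {comb : NatExpr → NatExpr → NatExpr} (hcomb : Closed₂ comb) :
    (product p q comb).Scoped 0 :=
  ⟨closed_exprM hp _, (closed_exprN hp).mul (closed_exprN hq) _,
    closed₂_pair (closed_exprN hq) _ _ _ (closed_exprZero hp _) (closed_exprZero hq _),
    scoped_prodTable (closed_exprN hp) (closed_exprN hq) (closed_exprN hp) (closed_exprN hq)
      (closed_posAdd hp) (closed_posAdd hq) (closed₂_pair (closed_exprN hq)),
    scoped_rowProdTable (closed_exprN hp) (closed_exprN hq) (closed_exprM hp)
      (closed_posDelta hp) (closed_posDelta hq) (closed₂_pair (closed_exprN hq)),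
    scoped_prodTable (closed_num _) (closed_num _) (closed_exprN hp) (closed_exprN hq)
      (closed_posAccept hp) (closed_posAccept hq) hcomb⟩

open Classical in
-- The operation tables combine entries by `x * M'.n + y`, the number of a pair of states. The
-- accepting set enters only through `op` on truth values, so intersection and union are handled
-- together.
theorem eval_product {M' : ForestAutomaton (Fin m)} {q : NatExpr} {n' : ℕ}
    (hp : ∀ v, p.eval N v = n) (h : M.WrittenAt N n) (hq : ∀ v, q.eval N v = n')
    (h' : M'.WrittenAt N n') {comb : NatExpr → NatExpr → NatExpr} {op : ℕ → ℕ → ℕ}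
    (hcomb : ∀ x y v, (comb x y).eval N v = op (x.eval N v) (y.eval N v))
    {E : Set (M.Q × M'.Q)}
    (hE : ∀ x y, (if (x, y) ∈ E then 1 else 0) =
      op (if x ∈ M.accept then 1 else 0) (if y ∈ M'.accept then 1 else 0)) (v : ℕ → ℕ) :
    (product p q comb).eval N 0 v = (M.prod M' E).nats := by
  have hpair := eval_pair (eval_exprN hq h')
  simp only [product, NatProg.eval, hpair, eval_mul, eval_exprM hp h, eval_exprN hp h,
    eval_exprN hq h', eval_exprZero hp h, eval_exprZero hq h']
  rw [eval_prodTable (eval_exprN hp h) (eval_exprN hq h') (eval_exprN hp h) (eval_exprN hq h')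
      (eval_posAdd hp) h.add (eval_posAdd hq) h'.add
      (op := fun x y => x * M'.n + y) hpair
      (F := fun i j => ((M.prod M' E).num ((M.prod M' E).num.symm i + (M.prod M' E).num.symm j)))
      fun i i' j j' => ?_,
    eval_rowProdTable (eval_exprN hp h) (eval_exprN hq h') (eval_exprM hp h)
      (eval_posDelta hp h) h.delta (eval_posDelta hq h') h'.delta
      (op := fun x y => x * M'.n + y) hpair
      (F := fun i a => ((M.prod M' E).num ((M.prod M' E).δ ((M.prod M' E).num.symm i) a)))
      fun i i' j => ?_,
    eval_prodTable (fun _ => eval_num 1) (fun _ => eval_num 1) (eval_exprN hp h)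
      (eval_exprN hq h') (eval_posAccept hp h) h.accept (eval_posAccept hq h') h'.accept hcomb
      (F := fun _ i => if (M.prod M' E).num.symm i ∈ (M.prod M' E).accept then 1 else 0)
      fun i i' j j' => ?_]
  · simp only [ForestAutomaton.nats, ForestAutomaton.header, tableSet_eq_natTable,
      table₂_eq_natTable, List.append_assoc]
    rw [← val_finProdFinEquiv]
    rfl
  · rw [← hE, ForestAutomaton.prod_num_symm]
    rfl
  · rw [ForestAutomaton.prod_num_symm]
    exact val_finProdFinEquiv _ _
  · rw [ForestAutomaton.prod_num_symm, ForestAutomaton.prod_num_symm]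
    exact val_finProdFinEquiv _ _

end AutomatonLayout

namespace ForestAutomaton

open AutomatonLayout

theorem logspaceComputable_compl :
    LogspaceComputable (fun x : Σ m : ℕ, ForestAutomaton (Fin m) => x.2.encode)
      (fun x => x.2.compl.encode) := by
  refine NatProg.logspaceComputable (NatProg.complProg (posAccept 0) (exprN 0))
    (NatProg.scoped_complProg (closed_posAccept closed_zero) (closed_exprN closed_zero))
    (fun x : Σ m : ℕ, ForestAutomaton (Fin m) => x.2.nats) (fun x => x.2.compl.nats) fun x => ?_
  have hx : x.2.WrittenAt x.2.nats 0 := x.2.writtenAt (P := []) (Q := []) (by simp) rfl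
  refine NatProg.eval_complProg (P := x.2.header) (E := {i | x.2.num.symm i ∈ x.2.accept}) rfl
    (fun v => ?_) (eval_exprN (fun _ => NatExpr.eval_zero) hx)
  rw [eval_posAccept (fun _ => NatExpr.eval_zero) hx, length_header, zero_add]

open Classical in
theorem logspaceComputable_prod {comb : NatExpr → NatExpr → NatExpr} (hc : Closed₂ comb)
    {op : ℕ → ℕ → ℕ}
    (hcomb : ∀ N x y v, (comb x y).eval N v = op (x.eval N v) (y.eval N v))
    (E : ∀ {m : ℕ} (M M' : ForestAutomaton (Fin m)), Set (M.Q × M'.Q))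
    (hE : ∀ {m : ℕ} (M M' : ForestAutomaton (Fin m)) x y, (if (x, y) ∈ E M M' then 1 else 0) =
      op (if x ∈ M.accept then 1 else 0) (if y ∈ M'.accept then 1 else 0)) :
    LogspaceComputable
      (fun x : Σ m : ℕ, ForestAutomaton (Fin m) × ForestAutomaton (Fin m) =>
        x.2.1.encode ++ x.2.2.encode)
      (fun x => (x.2.1.prod x.2.2 (E x.2.1 x.2.2)).encode) := by
  simp only [encode_eq, ← encodeNats_append]
  refine NatProg.logspaceComputable (product 0 (posEnd 0) comb)
    (scoped_product closed_zero (closed_posEnd closed_zero) hc) _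
    (fun x : Σ m : ℕ, ForestAutomaton (Fin m) × ForestAutomaton (Fin m) =>
      (x.2.1.prod x.2.2 (E x.2.1 x.2.2)).nats) fun x => ?_
  have h₁ := x.2.1.writtenAt (N := x.2.1.nats ++ x.2.2.nats) (P := []) rfl rfl
  have h₂ := x.2.2.writtenAt (N := x.2.1.nats ++ x.2.2.nats) (P := x.2.1.nats) (Q := [])
    (by simp) rfl
  have h0 : ∀ v, (0 : NatExpr).eval (x.2.1.nats ++ x.2.2.nats) v = 0 := fun _ => rfl
  exact eval_product h0 h₁ (fun v => by rw [eval_posEnd h0 h₁, zero_add]) h₂ (hcomb _)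
    (hE _ _) _

end ForestAutomaton

/-! ### Forest algebras in logarithmic space -/

namespace AlgebraRecognizer

/-- The encoding of a recognizer as a list of numbers, without the accepting set. -/
def header {m : ℕ} (R : AlgebraRecognizer (Fin m)) : List ℕ :=
  [m, R.nH, R.nV, (R.numH 0 : ℕ), (R.numV 1 : ℕ)]
    ++ table₂ (fun i j => R.numH (R.numH.symm i + R.numH.symm j))
    ++ table₂ (fun i j => R.numV (R.numV.symm i * R.numV.symm j))
    ++ table₂ (fun i j => R.numH (R.numV.symm i • R.numH.symm j))
    ++ table₁ (fun i => R.numV (R.alg.inl (R.numH.symm i)))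
    ++ table₁ (fun i => R.numV (R.alg.inr (R.numH.symm i)))
    ++ table₁ (fun a : Fin m => R.numV (R.hom.onV (Context.letter a)))

/-- The encoding of a recognizer as a list of numbers. -/
noncomputable def nats {m : ℕ} (R : AlgebraRecognizer (Fin m)) : List ℕ :=
  R.header ++ tableSet {i | R.numH.symm i ∈ R.accept}

theorem encode_eq {m : ℕ} (R : AlgebraRecognizer (Fin m)) : R.encode = encodeNats R.nats := rfl

theorem length_header {m : ℕ} (R : AlgebraRecognizer (Fin m)) :
    R.header.length = 5 + R.nH * R.nH + R.nV * R.nV + R.nV * R.nH + R.nH + R.nH + m := by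
  simp [header, table₂_eq_natTable, table₁_eq_natTable, length_natTable]; lia

theorem length_nats {m : ℕ} (R : AlgebraRecognizer (Fin m)) : R.nats.length =
    5 + R.nH * R.nH + R.nV * R.nV + R.nV * R.nH + R.nH + R.nH + m + R.nH := by
  simp [nats, length_header, tableSet]

open Classical in
/-- The recognizer `R` is written down in `N` from the position `p` on. -/
structure WrittenAt {m : ℕ} (R : AlgebraRecognizer (Fin m)) (N : List ℕ) (p : ℕ) : Prop where
  get_m : N.getD p 0 = m
  get_nH : N.getD (p + 1) 0 = R.nH
  get_nV : N.getD (p + 2) 0 = R.nV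
  get_zero : N.getD (p + 3) 0 = R.numH 0
  get_one : N.getD (p + 4) 0 = R.numV 1
  add : HasTable N (p + 5) fun i j => (R.numH (R.numH.symm i + R.numH.symm j) : ℕ)
  mul : HasTable N (p + 5 + R.nH * R.nH) fun i j =>
    (R.numV (R.numV.symm i * R.numV.symm j) : ℕ)
  act : HasTable N (p + 5 + R.nH * R.nH + R.nV * R.nV) fun i j =>
    (R.numH (R.numV.symm i • R.numH.symm j) : ℕ)
  inl : HasTable N (p + 5 + R.nH * R.nH + R.nV * R.nV + R.nV * R.nH)
    fun (_ : Fin 1) i => (R.numV (R.alg.inl (R.numH.symm i)) : ℕ)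
  inr : HasTable N (p + 5 + R.nH * R.nH + R.nV * R.nV + R.nV * R.nH + R.nH)
    fun (_ : Fin 1) i => (R.numV (R.alg.inr (R.numH.symm i)) : ℕ)
  letter : HasTable N (p + 5 + R.nH * R.nH + R.nV * R.nV + R.nV * R.nH + R.nH + R.nH)
    fun (_ : Fin 1) a => (R.numV (R.hom.onV (Context.letter a)) : ℕ)
  accept : HasTable N (p + 5 + R.nH * R.nH + R.nV * R.nV + R.nV * R.nH + R.nH + R.nH + m)
    fun (_ : Fin 1) i => if R.numH.symm i ∈ R.accept then 1 else 0

/-- The offset of each table is the total length of the parts before it. -/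
theorem writtenAt {m : ℕ} (R : AlgebraRecognizer (Fin m)) {N P Q : List ℕ}
    (hN : N = P ++ (R.nats ++ Q)) {p : ℕ} (hp : p = P.length) : R.WrittenAt N p := by
  subst hp
  simp only [nats, header, tableSet_eq_natTable, table₂_eq_natTable, table₁_eq_natTable,
    List.append_assoc] at hN
  constructor
  · simp [hN]
  · simp [hN]
  · simp [hN]
  · simp [hN]
  · simp [hN]
  · exact hasTable_append _ (P := P ++ [m, R.nH, R.nV, (R.numH 0 : ℕ), (R.numV 1 : ℕ)])
      (hN.trans (by simp only [List.append_assoc]; rfl)) (by simp)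
  · refine hasTable_append _ (P := P ++ ([m, R.nH, R.nV, (R.numH 0 : ℕ), (R.numV 1 : ℕ)] ++
      natTable _)) (hN.trans (by simp only [List.append_assoc]; rfl)) ?_
    simp [length_natTable]; lia
  · refine hasTable_append _ (P := P ++ ([m, R.nH, R.nV, (R.numH 0 : ℕ), (R.numV 1 : ℕ)] ++
      (natTable _ ++ natTable _))) (hN.trans (by simp only [List.append_assoc]; rfl)) ?_
    simp [length_natTable]; lia
  · refine hasTable_append _ (P := P ++ ([m, R.nH, R.nV, (R.numH 0 : ℕ), (R.numV 1 : ℕ)] ++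
      (natTable _ ++ (natTable _ ++ natTable _))))
      (hN.trans (by simp only [List.append_assoc]; rfl)) ?_
    simp [length_natTable]; lia
  · refine hasTable_append _ (P := P ++ ([m, R.nH, R.nV, (R.numH 0 : ℕ), (R.numV 1 : ℕ)] ++
      (natTable _ ++ (natTable _ ++ (natTable _ ++ natTable (n := 1) _)))))
      (hN.trans (by simp only [List.append_assoc]; rfl)) ?_
    simp [length_natTable]; lia
  · refine hasTable_append _ (P := P ++ ([m, R.nH, R.nV, (R.numH 0 : ℕ), (R.numV 1 : ℕ)] ++
      (natTable _ ++ (natTable _ ++ (natTable _ ++ (natTable (n := 1) _ ++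
        natTable (n := 1) _))))))
      (hN.trans (by simp only [List.append_assoc]; rfl)) ?_
    simp [length_natTable]; lia
  · refine hasTable_append _ (P := P ++ ([m, R.nH, R.nV, (R.numH 0 : ℕ), (R.numV 1 : ℕ)] ++
      (natTable _ ++ (natTable _ ++ (natTable _ ++ (natTable (n := 1) _ ++
        (natTable (n := 1) _ ++ natTable (n := 1) _)))))))
      (hN.trans (by simp only [List.append_assoc]; rfl)) ?_
    simp [length_natTable]; lia

theorem prod_numH_symm {A : Type} (R S : AlgebraRecognizer A) (E : Set (R.alg.H × S.alg.H))
    (i : Fin R.nH) (i' : Fin S.nH) : (R.prod S E).numH.symm (finProdFinEquiv (i, i')) =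
      (R.numH.symm i, S.numH.symm i') :=
  congrArg (R.numH.symm.prodCongr S.numH.symm) (finProdFinEquiv.symm_apply_apply (i, i'))

theorem prod_numV_symm {A : Type} (R S : AlgebraRecognizer A) (E : Set (R.alg.H × S.alg.H))
    (i : Fin R.nV) (i' : Fin S.nV) : (R.prod S E).numV.symm (finProdFinEquiv (i, i')) =
      (R.numV.symm i, S.numV.symm i') :=
  congrArg (R.numV.symm.prodCongr S.numV.symm) (finProdFinEquiv.symm_apply_apply (i, i'))

end AlgebraRecognizer

namespace AlgebraLayout

open NatExpr NatProg

/-! Expressions for the parts of the encoding of a recognizer that starts at the position `p`. -/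

def exprM (p : NatExpr) : NatExpr := get p
def exprH (p : NatExpr) : NatExpr := get (p + num 1)
def exprV (p : NatExpr) : NatExpr := get (p + num 2)
def exprZero (p : NatExpr) : NatExpr := get (p + num 3)
def exprOne (p : NatExpr) : NatExpr := get (p + num 4)
def posAdd (p : NatExpr) : NatExpr := p + num 5
def posMul (p : NatExpr) : NatExpr := posAdd p + exprH p * exprH p
def posAct (p : NatExpr) : NatExpr := posMul p + exprV p * exprV p
def posInl (p : NatExpr) : NatExpr := posAct p + exprV p * exprH p
def posInr (p : NatExpr) : NatExpr := posInl p + exprH p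
def posLetter (p : NatExpr) : NatExpr := posInr p + exprH p
def posAccept (p : NatExpr) : NatExpr := posLetter p + exprM p
def posEnd (p : NatExpr) : NatExpr := posAccept p + exprH p

variable {p : NatExpr}

theorem closed_exprM (hp : p.Closed) : (exprM p).Closed := hp
theorem closed_exprH (hp : p.Closed) : (exprH p).Closed := hp.add (closed_num _)
theorem closed_exprV (hp : p.Closed) : (exprV p).Closed := hp.add (closed_num _)
theorem closed_exprZero (hp : p.Closed) : (exprZero p).Closed := hp.add (closed_num _)
theorem closed_exprOne (hp : p.Closed) : (exprOne p).Closed := hp.add (closed_num _)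
theorem closed_posAdd (hp : p.Closed) : (posAdd p).Closed := hp.add (closed_num _)
theorem closed_posMul (hp : p.Closed) : (posMul p).Closed :=
  (closed_posAdd hp).add ((closed_exprH hp).mul (closed_exprH hp))
theorem closed_posAct (hp : p.Closed) : (posAct p).Closed :=
  (closed_posMul hp).add ((closed_exprV hp).mul (closed_exprV hp))
theorem closed_posInl (hp : p.Closed) : (posInl p).Closed :=
  (closed_posAct hp).add ((closed_exprV hp).mul (closed_exprH hp))
theorem closed_posInr (hp : p.Closed) : (posInr p).Closed :=
  (closed_posInl hp).add (closed_exprH hp)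
theorem closed_posLetter (hp : p.Closed) : (posLetter p).Closed :=
  (closed_posInr hp).add (closed_exprH hp)
theorem closed_posAccept (hp : p.Closed) : (posAccept p).Closed :=
  (closed_posLetter hp).add (closed_exprM hp)
theorem closed_posEnd (hp : p.Closed) : (posEnd p).Closed :=
  (closed_posAccept hp).add (closed_exprH hp)

variable {m : ℕ} {R : AlgebraRecognizer (Fin m)} {N : List ℕ} {n : ℕ}

theorem eval_exprM (hp : ∀ v, p.eval N v = n) (h : R.WrittenAt N n) (v : ℕ → ℕ) :
    (exprM p).eval N v = m := by
  rw [exprM, eval_get, hp, h.get_m]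
theorem eval_exprH (hp : ∀ v, p.eval N v = n) (h : R.WrittenAt N n) (v : ℕ → ℕ) :
    (exprH p).eval N v = R.nH := by
  rw [exprH, eval_get, NatExpr.eval_add, eval_num, hp, h.get_nH]
theorem eval_exprV (hp : ∀ v, p.eval N v = n) (h : R.WrittenAt N n) (v : ℕ → ℕ) :
    (exprV p).eval N v = R.nV := by
  rw [exprV, eval_get, NatExpr.eval_add, eval_num, hp, h.get_nV]
theorem eval_exprZero (hp : ∀ v, p.eval N v = n) (h : R.WrittenAt N n) (v : ℕ → ℕ) :
    (exprZero p).eval N v = R.numH 0 := by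
  rw [exprZero, eval_get, NatExpr.eval_add, eval_num, hp, h.get_zero]
theorem eval_exprOne (hp : ∀ v, p.eval N v = n) (h : R.WrittenAt N n) (v : ℕ → ℕ) :
    (exprOne p).eval N v = R.numV 1 := by
  rw [exprOne, eval_get, NatExpr.eval_add, eval_num, hp, h.get_one]
theorem eval_posAdd (hp : ∀ v, p.eval N v = n) (v : ℕ → ℕ) :
    (posAdd p).eval N v = n + 5 := by
  rw [posAdd, NatExpr.eval_add, eval_num, hp]
theorem eval_posMul (hp : ∀ v, p.eval N v = n) (h : R.WrittenAt N n) (v : ℕ → ℕ) :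
    (posMul p).eval N v = n + 5 + R.nH * R.nH := by
  simp only [posMul, NatExpr.eval_add, eval_mul, eval_posAdd hp, eval_exprH hp h]
theorem eval_posAct (hp : ∀ v, p.eval N v = n) (h : R.WrittenAt N n) (v : ℕ → ℕ) :
    (posAct p).eval N v = n + 5 + R.nH * R.nH + R.nV * R.nV := by
  simp only [posAct, NatExpr.eval_add, eval_mul, eval_posMul hp h, eval_exprV hp h]
theorem eval_posInl (hp : ∀ v, p.eval N v = n) (h : R.WrittenAt N n) (v : ℕ → ℕ) :
    (posInl p).eval N v = n + 5 + R.nH * R.nH + R.nV * R.nV + R.nV * R.nH := by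
  simp only [posInl, NatExpr.eval_add, eval_mul, eval_posAct hp h, eval_exprV hp h,
    eval_exprH hp h]
theorem eval_posInr (hp : ∀ v, p.eval N v = n) (h : R.WrittenAt N n) (v : ℕ → ℕ) :
    (posInr p).eval N v = n + 5 + R.nH * R.nH + R.nV * R.nV + R.nV * R.nH + R.nH := by
  simp only [posInr, NatExpr.eval_add, eval_posInl hp h, eval_exprH hp h]
theorem eval_posLetter (hp : ∀ v, p.eval N v = n) (h : R.WrittenAt N n) (v : ℕ → ℕ) :
    (posLetter p).eval N v =
      n + 5 + R.nH * R.nH + R.nV * R.nV + R.nV * R.nH + R.nH + R.nH := by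
  simp only [posLetter, NatExpr.eval_add, eval_posInr hp h, eval_exprH hp h]
theorem eval_posAccept (hp : ∀ v, p.eval N v = n) (h : R.WrittenAt N n) (v : ℕ → ℕ) :
    (posAccept p).eval N v =
      n + 5 + R.nH * R.nH + R.nV * R.nV + R.nV * R.nH + R.nH + R.nH + m := by
  simp only [posAccept, NatExpr.eval_add, eval_posLetter hp h, eval_exprM hp h]
theorem eval_posEnd (hp : ∀ v, p.eval N v = n) (h : R.WrittenAt N n) (v : ℕ → ℕ) :
    (posEnd p).eval N v = n + R.nats.length := by
  simp only [posEnd, NatExpr.eval_add, eval_posAccept hp h, eval_exprH hp h,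
    AlgebraRecognizer.length_nats]
  lia

/-- The product of two recognizers written down from the positions `p` and `q` on. -/
def product (p q : NatExpr) (comb : NatExpr → NatExpr → NatExpr) : NatProg :=
  seq (emit (exprM p)) <| seq (emit (exprH p * exprH q)) <| seq (emit (exprV p * exprV q)) <|
  seq (emit (pair (exprH q) (exprZero p) (exprZero q))) <|
  seq (emit (pair (exprV q) (exprOne p) (exprOne q))) <|
  seq (prodTable (exprH p) (exprH q) (exprH p) (exprH q) (posAdd p) (posAdd q)
    (pair (exprH q))) <|
  seq (prodTable (exprV p) (exprV q) (exprV p) (exprV q) (posMul p) (posMul q)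
    (pair (exprV q))) <|
  seq (prodTable (exprV p) (exprV q) (exprH p) (exprH q) (posAct p) (posAct q)
    (pair (exprH q))) <|
  seq (prodTable (num 1) (num 1) (exprH p) (exprH q) (posInl p) (posInl q) (pair (exprV q))) <|
  seq (prodTable (num 1) (num 1) (exprH p) (exprH q) (posInr p) (posInr q) (pair (exprV q))) <|
  seq (rowProdTable (num 1) (num 1) (exprM p) (posLetter p) (posLetter q) (pair (exprV q))) <|
  prodTable (num 1) (num 1) (exprH p) (exprH q) (posAccept p) (posAccept q) comb

theorem scoped_product {q : NatExpr} (hp : p.Closed) (hq : q.Closed)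
    {comb : NatExpr → NatExpr → NatExpr} (hcomb : Closed₂ comb) :
    (product p q comb).Scoped 0 :=
  ⟨closed_exprM hp _, (closed_exprH hp).mul (closed_exprH hq) _,
    (closed_exprV hp).mul (closed_exprV hq) _,
    closed₂_pair (closed_exprH hq) _ _ _ (closed_exprZero hp _) (closed_exprZero hq _),
    closed₂_pair (closed_exprV hq) _ _ _ (closed_exprOne hp _) (closed_exprOne hq _),
    scoped_prodTable (closed_exprH hp) (closed_exprH hq) (closed_exprH hp) (closed_exprH hq)
      (closed_posAdd hp) (closed_posAdd hq) (closed₂_pair (closed_exprH hq)),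
    scoped_prodTable (closed_exprV hp) (closed_exprV hq) (closed_exprV hp) (closed_exprV hq)
      (closed_posMul hp) (closed_posMul hq) (closed₂_pair (closed_exprV hq)),
    scoped_prodTable (closed_exprV hp) (closed_exprV hq) (closed_exprH hp) (closed_exprH hq)
      (closed_posAct hp) (closed_posAct hq) (closed₂_pair (closed_exprH hq)),
    scoped_prodTable (closed_num _) (closed_num _) (closed_exprH hp) (closed_exprH hq)
      (closed_posInl hp) (closed_posInl hq) (closed₂_pair (closed_exprV hq)),
    scoped_prodTable (closed_num _) (closed_num _) (closed_exprH hp) (closed_exprH hq)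
      (closed_posInr hp) (closed_posInr hq) (closed₂_pair (closed_exprV hq)),
    scoped_rowProdTable (closed_num _) (closed_num _) (closed_exprM hp)
      (closed_posLetter hp) (closed_posLetter hq) (closed₂_pair (closed_exprV hq)),
    scoped_prodTable (closed_num _) (closed_num _) (closed_exprH hp) (closed_exprH hq)
      (closed_posAccept hp) (closed_posAccept hq) hcomb⟩

open Classical in
-- Entries in `H` are paired with the factor `S.nH`, entries in `V` with `S.nV`: the values of a
-- table, not its arguments, decide which one is used.
theorem eval_product {S : AlgebraRecognizer (Fin m)} {q : NatExpr} {n' : ℕ}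
    (hp : ∀ v, p.eval N v = n) (h : R.WrittenAt N n) (hq : ∀ v, q.eval N v = n')
    (h' : S.WrittenAt N n') {comb : NatExpr → NatExpr → NatExpr} {op : ℕ → ℕ → ℕ}
    (hcomb : ∀ x y v, (comb x y).eval N v = op (x.eval N v) (y.eval N v))
    {E : Set (R.alg.H × S.alg.H)}
    (hE : ∀ x y, (if (x, y) ∈ E then 1 else 0) =
      op (if x ∈ R.accept then 1 else 0) (if y ∈ S.accept then 1 else 0)) (v : ℕ → ℕ) :
    (product p q comb).eval N 0 v = (R.prod S E).nats := by
  have hpairH := eval_pair (eval_exprH hq h')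
  have hpairV := eval_pair (eval_exprV hq h')
  set T := R.prod S E
  have hH : ∀ i i', T.numH.symm (finProdFinEquiv (i, i')) = (R.numH.symm i, S.numH.symm i') :=
    R.prod_numH_symm S E
  have hV : ∀ i i', T.numV.symm (finProdFinEquiv (i, i')) = (R.numV.symm i, S.numV.symm i') :=
    R.prod_numV_symm S E
  simp only [product, NatProg.eval, hpairH, hpairV, eval_mul, eval_exprM hp h, eval_exprH hp h,
    eval_exprH hq h', eval_exprV hp h, eval_exprV hq h', eval_exprZero hp h, eval_exprZero hq h',
    eval_exprOne hp h, eval_exprOne hq h']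
  rw [eval_prodTable (eval_exprH hp h) (eval_exprH hq h') (eval_exprH hp h) (eval_exprH hq h')
      (eval_posAdd hp) h.add (eval_posAdd hq) h'.add (op := fun x y => x * S.nH + y) hpairH
      (F := fun i j => T.numH (T.numH.symm i + T.numH.symm j)) fun i i' j j' => ?_,
    eval_prodTable (eval_exprV hp h) (eval_exprV hq h') (eval_exprV hp h) (eval_exprV hq h')
      (eval_posMul hp h) h.mul (eval_posMul hq h') h'.mul (op := fun x y => x * S.nV + y) hpairV
      (F := fun i j => T.numV (T.numV.symm i * T.numV.symm j)) fun i i' j j' => ?_,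
    eval_prodTable (eval_exprV hp h) (eval_exprV hq h') (eval_exprH hp h) (eval_exprH hq h')
      (eval_posAct hp h) h.act (eval_posAct hq h') h'.act (op := fun x y => x * S.nH + y) hpairH
      (F := fun i j => T.numH (T.numV.symm i • T.numH.symm j)) fun i i' j j' => ?_,
    eval_prodTable (fun _ => eval_num 1) (fun _ => eval_num 1) (eval_exprH hp h)
      (eval_exprH hq h') (eval_posInl hp h) h.inl (eval_posInl hq h') h'.inl
      (op := fun x y => x * S.nV + y) hpairV
      (F := fun _ i => T.numV (T.alg.inl (T.numH.symm i))) fun i i' j j' => ?_,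
    eval_prodTable (fun _ => eval_num 1) (fun _ => eval_num 1) (eval_exprH hp h)
      (eval_exprH hq h') (eval_posInr hp h) h.inr (eval_posInr hq h') h'.inr
      (op := fun x y => x * S.nV + y) hpairV
      (F := fun _ i => T.numV (T.alg.inr (T.numH.symm i))) fun i i' j j' => ?_,
    eval_rowProdTable (fun _ => eval_num 1) (fun _ => eval_num 1) (eval_exprM hp h)
      (eval_posLetter hp h) h.letter (eval_posLetter hq h') h'.letter
      (op := fun x y => x * S.nV + y) hpairV
      (F := fun _ a => T.numV (T.hom.onV (Context.letter a))) fun i i' j => ?_,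
    eval_prodTable (fun _ => eval_num 1) (fun _ => eval_num 1) (eval_exprH hp h)
      (eval_exprH hq h') (eval_posAccept hp h) h.accept (eval_posAccept hq h') h'.accept hcomb
      (F := fun _ i => if T.numH.symm i ∈ T.accept then 1 else 0) fun i i' j j' => ?_]
  · simp only [AlgebraRecognizer.nats, AlgebraRecognizer.header, tableSet_eq_natTable,
      table₂_eq_natTable, table₁_eq_natTable, List.append_assoc]
    rw [← val_finProdFinEquiv, ← val_finProdFinEquiv]
    rfl
  · rw [← hE, hH]
    rfl
  · exact val_finProdFinEquiv _ _
  · rw [hH]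
    exact val_finProdFinEquiv _ _
  · rw [hH]
    exact val_finProdFinEquiv _ _
  · rw [hH, hV]
    exact val_finProdFinEquiv _ _
  · rw [hV, hV]
    exact val_finProdFinEquiv _ _
  · rw [hH, hH]
    exact val_finProdFinEquiv _ _

end AlgebraLayout

namespace AlgebraRecognizer

open AlgebraLayout

theorem logspaceComputable_compl :
    LogspaceComputable (fun x : Σ m : ℕ, AlgebraRecognizer (Fin m) => x.2.encode)
      (fun x => x.2.compl.encode) := by
  refine NatProg.logspaceComputable (NatProg.complProg (posAccept 0) (exprH 0))
    (NatProg.scoped_complProg (closed_posAccept closed_zero) (closed_exprH closed_zero))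
    (fun x : Σ m : ℕ, AlgebraRecognizer (Fin m) => x.2.nats) (fun x => x.2.compl.nats) fun x => ?_
  have hx : x.2.WrittenAt x.2.nats 0 := x.2.writtenAt (P := []) (Q := []) (by simp) rfl
  refine NatProg.eval_complProg (P := x.2.header) (E := {i | x.2.numH.symm i ∈ x.2.accept}) rfl
    (fun v => ?_) (eval_exprH (fun _ => NatExpr.eval_zero) hx)
  rw [eval_posAccept (fun _ => NatExpr.eval_zero) hx, length_header, zero_add]

open Classical in
theorem logspaceComputable_prod {comb : NatExpr → NatExpr → NatExpr} (hc : Closed₂ comb)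
    {op : ℕ → ℕ → ℕ}
    (hcomb : ∀ N x y v, (comb x y).eval N v = op (x.eval N v) (y.eval N v))
    (E : ∀ {m : ℕ} (R S : AlgebraRecognizer (Fin m)), Set (R.alg.H × S.alg.H))
    (hE : ∀ {m : ℕ} (R S : AlgebraRecognizer (Fin m)) x y, (if (x, y) ∈ E R S then 1 else 0) =
      op (if x ∈ R.accept then 1 else 0) (if y ∈ S.accept then 1 else 0)) :
    LogspaceComputable
      (fun x : Σ m : ℕ, AlgebraRecognizer (Fin m) × AlgebraRecognizer (Fin m) =>
        x.2.1.encode ++ x.2.2.encode)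
      (fun x => (x.2.1.prod x.2.2 (E x.2.1 x.2.2)).encode) := by
  simp only [encode_eq, ← encodeNats_append]
  refine NatProg.logspaceComputable (product 0 (posEnd 0) comb)
    (scoped_product closed_zero (closed_posEnd closed_zero) hc) _
    (fun x : Σ m : ℕ, AlgebraRecognizer (Fin m) × AlgebraRecognizer (Fin m) =>
      (x.2.1.prod x.2.2 (E x.2.1 x.2.2)).nats) fun x => ?_
  have h₁ := x.2.1.writtenAt (N := x.2.1.nats ++ x.2.2.nats) (P := []) rfl rfl
  have h₂ := x.2.2.writtenAt (N := x.2.1.nats ++ x.2.2.nats) (P := x.2.1.nats) (Q := [])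
    (by simp) rfl
  have h0 : ∀ v, (0 : NatExpr).eval (x.2.1.nats ++ x.2.2.nats) v = 0 := fun _ => rfl
  exact eval_product h0 h₁ (fun v => by rw [eval_posEnd h0 h₁, zero_add]) h₂ (hcomb _)
    (hE _ _) _

end AlgebraRecognizer

/-! ### Recognizable languages -/

namespace ForestAutomaton

/-! ### From automata to faithful forest algebras. -/

variable {A : Type} (M : ForestAutomaton A)

theorem eval_add (f g : Forest A) : M.eval (f + g) = M.eval f + M.eval g := by
  induction f with
  | nil => exact (zero_add _).symm
  | cons a f f' _ ih => rw [Forest.cons_add, eval, ih, eval, add_assoc]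

theorem eval_tree (a : A) (f : Forest A) : M.eval (Forest.tree a f) = M.δ (M.eval f) a :=
  add_zero _

/-- The transformation of the states by a context. -/
def evalContext {A : Type} (M : ForestAutomaton A) : Context A → Function.End M.Q
  | .hole l r => fun q => M.eval l + q + M.eval r
  | .node l a c r => fun q => M.eval l + M.δ (M.evalContext c q) a + M.eval r

theorem eval_smul (c : Context A) (f : Forest A) : M.eval (c • f) = M.evalContext c (M.eval f) := by
  change M.eval (c.apply f) = _
  induction c with
  | hole l r => simp [Context.apply, evalContext, eval_add]
  | node l a c r ih => simp [Context.apply, evalContext, eval_add, eval_tree, ih]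

theorem evalContext_mul (c d : Context A) :
    M.evalContext (c * d) = M.evalContext c * M.evalContext d := by
  induction c with
  | hole l r =>
    rw [Context.hole_mul]
    funext q
    change _ = M.eval l + M.evalContext d q + M.eval r
    cases d <;> simp [Context.surround, evalContext, eval_add, add_assoc]
  | node l a c r ih =>
    rw [Context.node_mul, evalContext, ih]
    rfl

/-- The forest algebra of all transformations of the states of an automaton. -/
def algebra : ForestAlgebra where
  H := M.Q
  V := Function.End M.Q
  inl h := fun g => h + g
  inr h := fun g => g + h
  inl_smul _ _ := rfl
  inr_smul _ _ := rfl

/-- The homomorphism given by the runs of an automaton. -/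
def algebraHom : ForestAlgebra.Hom (ForestAlgebra.free A) M.algebra where
  onH := { toFun := M.eval, map_zero' := rfl, map_add' := M.eval_add }
  onV :=
    { toFun := M.evalContext
      map_one' := by
        funext q
        change 0 + q + 0 = q
        rw [zero_add, add_zero]
      map_mul' := M.evalContext_mul }
  map_smul := M.eval_smul
  map_inl h := by
    funext q
    change M.eval h + q + 0 = M.eval h + q
    rw [add_zero]
  map_inr h := by
    funext q
    change 0 + q + M.eval h = q + M.eval h
    rw [zero_add]

/-- The vertical monoid is taken to be all maps `Q → Q`, not just those induced by contexts: it is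
still finite, contains `h + □` and `□ + h`, and is faithful by extensionality. -/
theorem exists_faithful_recognizer :
    ∃ R : AlgebraRecognizer A, R.alg.Faithful ∧ R.language = M.language := by
  have : Finite M.Q := Finite.of_equiv _ M.num.symm
  have : Finite M.algebra.V := inferInstanceAs (Finite (M.Q → M.Q))
  exact ⟨⟨M.algebra, M.n, Nat.card M.algebra.V, M.num, Finite.equivFin _, M.algebraHom,
    M.accept⟩, fun v w h => funext h, rfl⟩

end ForestAutomaton

namespace AlgebraRecognizer

/-! ### From forest algebras to automata. -/

variable {A : Type} (R : AlgebraRecognizer A)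

/-- The automaton whose states are the elements of the horizontal monoid. -/
def automaton : ForestAutomaton A where
  Q := R.alg.H
  n := R.nH
  num := R.numH
  δ q a := R.hom.onV (Context.letter a) • q
  accept := R.accept

theorem eval_automaton (f : Forest A) : R.automaton.eval f = R.hom.onH f := by
  induction f with
  | nil => exact (map_zero R.hom.onH).symm
  | cons a f g ihf ihg =>
    -- This decomposition reduces the homomorphism to its values on letters.
    have h : Forest.cons a f g = Context.letter a • f + g := by
      change _ = (0 + Forest.tree a (0 + f + 0) + 0) + g
      simp only [zero_add, add_zero]
      rfl
    have h' : R.hom.onH (Context.letter a • f + g) =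
        R.hom.onV (Context.letter a) • R.hom.onH f + R.hom.onH g :=
      (map_add R.hom.onH _ _).trans (congrArg (· + _) (R.hom.map_smul _ _))
    rw [ForestAutomaton.eval, ihf, ihg, h]
    exact h'.symm

theorem language_automaton : R.automaton.language = R.language := by
  ext f
  change R.automaton.eval f ∈ R.accept ↔ _
  rw [eval_automaton]
  rfl

end AlgebraRecognizer

/-! ### Boolean operations and the equivalence of the models. -/

theorem ForestAutomaton.eval_compl {A : Type} (M : ForestAutomaton A) (f : Forest A) :
    M.compl.eval f = M.eval f := by
  induction f with
  | nil => rfl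
  | cons a f g ihf ihg =>
    rw [ForestAutomaton.eval, ihf, ihg]
    rfl

theorem ForestAutomaton.eval_prod {A : Type} (M N : ForestAutomaton A) (E : Set (M.Q × N.Q))
    (f : Forest A) : (M.prod N E).eval f = (M.eval f, N.eval f) := by
  induction f with
  | nil => rfl
  | cons a f g ihf ihg =>
    rw [ForestAutomaton.eval, ihf, ihg]
    rfl

/-- Each component is tested on pairs whose other entry is `0`. -/
theorem ForestAlgebra.Faithful.prod {S T : ForestAlgebra} (hS : S.Faithful) (hT : T.Faithful) :
    (S.prod T).Faithful := fun _ _ h =>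
  Prod.ext (hS _ _ fun x => congrArg Prod.fst (h (x, 0)))
    (hT _ _ fun y => congrArg Prod.snd (h (0, y)))

theorem recognizable_tfae {A : Type} (L : Set (Forest A)) : List.TFAE [
    AlgebraRecognizable L,
    ∃ R : AlgebraRecognizer A, R.alg.Faithful ∧ R.language = L,
    AutomatonRecognizable L] := by
  tfae_have 1 → 3 := by
    rintro ⟨R, rfl⟩
    exact ⟨R.automaton, R.language_automaton⟩
  tfae_have 3 → 2 := by
    rintro ⟨M, rfl⟩
    exact M.exists_faithful_recognizer
  tfae_have 2 → 1 := fun ⟨R, _, hR⟩ => ⟨R, hR⟩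
  tfae_finish

/-- The automaton with one state, which accepts all forests. -/
def ForestAutomaton.univ (A : Type) : ForestAutomaton A where
  Q := Fin 1
  n := 1
  num := Equiv.refl _
  δ _ _ := 0
  accept := Set.univ

/-- The Boolean algebra of recognizable languages. -/
def recognizableLanguages (A : Type) : BooleanSubalgebra (Set (Forest A)) where
  carrier := {L | AlgebraRecognizable L}
  supClosed' := by
    rintro _ ⟨R, rfl⟩ _ ⟨S, rfl⟩
    exact ⟨R.union S, rfl⟩
  infClosed' := by
    rintro _ ⟨R, rfl⟩ _ ⟨S, rfl⟩
    exact ⟨R.inter S, rfl⟩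
  compl_mem' := by
    rintro _ ⟨R, rfl⟩
    exact ⟨R.compl, rfl⟩
  -- The empty language is accepted by the complement of the one-state automaton and is carried over
  -- to algebras by the equivalence.
  bot_mem' := by
    have h := (recognizable_tfae (∅ : Set (Forest A))).out 2 0
    refine h.1 ⟨(ForestAutomaton.univ A).compl, ?_⟩
    exact Set.eq_empty_iff_forall_notMem.2 fun f h => h (Set.mem_univ _)

theorem mainTheorem10 :
    -- the class of recognizable languages is a Boolean algebra, the same one for both models
    (∀ (A : Type) [Finite A],
      (∃ B : BooleanSubalgebra (Set (Forest A)),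
        ∀ L : Set (Forest A), L ∈ B ↔ AlgebraRecognizable L) ∧
      ∀ L : Set (Forest A), List.TFAE [
        AlgebraRecognizable L,
        ∃ R : AlgebraRecognizer A, R.alg.Faithful ∧ R.language = L,
        AutomatonRecognizable L]) ∧
    -- the complement and product constructions are correct
    (∀ (A : Type) [Finite A] (R S : AlgebraRecognizer A),
      R.compl.language = R.languageᶜ ∧
      (R.inter S).language = R.language ∩ S.language ∧
      (R.union S).language = R.language ∪ S.language ∧
      (R.alg.Faithful → R.compl.alg.Faithful) ∧
      (R.alg.Faithful → S.alg.Faithful →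
        (R.inter S).alg.Faithful ∧ (R.union S).alg.Faithful)) ∧
    (∀ (A : Type) [Finite A] (M N : ForestAutomaton A),
      M.compl.language = M.languageᶜ ∧
      (M.inter N).language = M.language ∩ N.language ∧
      (M.union N).language = M.language ∪ N.language) ∧
    -- they can be carried out in logarithmic space, for forest algebras
    LogspaceComputable
      (fun x : Σ m : ℕ, AlgebraRecognizer (Fin m) => x.2.encode)
      (fun x => x.2.compl.encode) ∧
    LogspaceComputable
      (fun x : Σ m : ℕ, AlgebraRecognizer (Fin m) × AlgebraRecognizer (Fin m) =>
        x.2.1.encode ++ x.2.2.encode)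
      (fun x => (x.2.1.inter x.2.2).encode) ∧
    LogspaceComputable
      (fun x : Σ m : ℕ, AlgebraRecognizer (Fin m) × AlgebraRecognizer (Fin m) =>
        x.2.1.encode ++ x.2.2.encode)
      (fun x => (x.2.1.union x.2.2).encode) ∧
    -- and for deterministic forest automata
    LogspaceComputable
      (fun x : Σ m : ℕ, ForestAutomaton (Fin m) => x.2.encode)
      (fun x => x.2.compl.encode) ∧
    LogspaceComputable
      (fun x : Σ m : ℕ, ForestAutomaton (Fin m) × ForestAutomaton (Fin m) =>
        x.2.1.encode ++ x.2.2.encode)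
      (fun x => (x.2.1.inter x.2.2).encode) ∧
    LogspaceComputable
      (fun x : Σ m : ℕ, ForestAutomaton (Fin m) × ForestAutomaton (Fin m) =>
        x.2.1.encode ++ x.2.2.encode)
      (fun x => (x.2.1.union x.2.2).encode) := by

  refine ⟨fun A _ => ⟨⟨recognizableLanguages A, fun L => Iff.rfl⟩, recognizable_tfae⟩,
    fun A _ R S => ⟨rfl, rfl, rfl, id, fun hR hS => ⟨hR.prod hS, hR.prod hS⟩⟩,
    fun A _ M N => ⟨?_, ?_, ?_⟩,
    AlgebraRecognizer.logspaceComputable_compl,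
    AlgebraRecognizer.logspaceComputable_prod NatExpr.closed₂_conj (fun _ _ _ _ => rfl)
      (fun R S => {p | p.1 ∈ R.accept ∧ p.2 ∈ S.accept}) fun R S x y => ?_,
    AlgebraRecognizer.logspaceComputable_prod NatExpr.closed₂_disj
      -- Testing against `0` twice maps the sum of two truth values, which may be `2`, back to `0`
      -- or `1`.
      (op := fun a b => if (if a + b = 0 then 1 else 0) = 0 then 1 else 0) (fun _ _ _ _ => rfl)
      (fun R S => {p | p.1 ∈ R.accept ∨ p.2 ∈ S.accept}) fun R S x y => ?_,
    ForestAutomaton.logspaceComputable_compl,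
    ForestAutomaton.logspaceComputable_prod NatExpr.closed₂_conj (fun _ _ _ _ => rfl)
      (fun M N => {p | p.1 ∈ M.accept ∧ p.2 ∈ N.accept}) fun M N x y => ?_,
    ForestAutomaton.logspaceComputable_prod NatExpr.closed₂_disj
      (op := fun a b => if (if a + b = 0 then 1 else 0) = 0 then 1 else 0) (fun _ _ _ _ => rfl)
      (fun M N => {p | p.1 ∈ M.accept ∨ p.2 ∈ N.accept}) fun M N x y => ?_⟩
  · ext f
    change M.compl.eval f ∈ M.acceptᶜ ↔ _
    rw [ForestAutomaton.eval_compl]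
    rfl
  · ext f
    change (M.inter N).eval f ∈ (M.inter N).accept ↔ _
    rw [ForestAutomaton.inter, ForestAutomaton.eval_prod]
    rfl
  · ext f
    change (M.union N).eval f ∈ (M.union N).accept ↔ _
    rw [ForestAutomaton.union, ForestAutomaton.eval_prod]
    rfl
  · by_cases hx : x ∈ R.accept <;> by_cases hy : y ∈ S.accept <;> simp [hx, hy]
  · by_cases hx : x ∈ R.accept <;> by_cases hy : y ∈ S.accept <;> simp [hx, hy]
  · by_cases hx : x ∈ M.accept <;> by_cases hy : y ∈ N.accept <;> simp [hx, hy]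
  · by_cases hx : x ∈ M.accept <;> by_cases hy : y ∈ N.accept <;> simp [hx, hy]
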